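/- **Karlin–McGregor formula for open quantum walks on $\mathbb Z$.** Let $d\ge 1$ and let $(A_n)_{n\in\mathbb Z},(B_n)_{n\in\mathbb Z},(C_n)_{n\in\mathbb Z},(H_n)_{n\in\mathbb Z}$ be bounded sequences of complex $d\times d$ matrices, $H_n$ Hermitian. They define a nearest-neighbour continuous-time open quantum walk (CTOQW) on $\mathbb Z$ with internal space $\mathbb C^d$: $A_n$, $B_n$, $C_n$ are the transition operators from $n$ to $n+1$, $n$, $n-1$, and $H_n$ is the local Hamiltonian. Write $\lceil X\rceil=X\otimes\overline X$ and $$G_n=-iH_n-\tfrac12\,(A_n^*A_n+B_n^*B_n+C_n^*C_n),\qquad T_n=G_n\otimes I+I\otimes\overline{G_n}+\lceil B_n\rceil .$$ In the row-stacking $\mathrm{vec}$ representation the generator is the bounded operator $L$ on $\ell^1(\mathbb Z;\mathbb C^{d^2})$ whose block matrix is tridiagonal, with blocks $$L_{n+1,n}=\lceil A_n\rceil,\qquad L_{n,n}=T_n,\qquad L_{n-1,n}=\lceil C_n\rceil .$$ Let $\Lambda_{ji}(t)$ be the $(j,i)$ block of $e^{tL}$. Assume that $A_n$ is nonsingular for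 $n\ge 0$, that $C_n$ is nonsingular for $n\le -1$, and that there are nonsingular matrices $R_n$ and Hermitian matrices $E_n$ of size $d^2\times d^2$ ($n\in\mathbb Z$) with $$\lceil A_n\rceil^*R_{n+1}^*R_{n+1}=R_n^*R_n\lceil C_{n+1}\rceil,\qquad R_nT_n=E_nR_n\qquad(n\in\mathbb Z).$$ Put $\Pi_n=(R_n^*R_n)^{-1}$. Let $Q_n^1,Q_n^2$ ($n\in\mathbb Z$) be the $d^2\times d^2$ matrix polynomials with $Q^1_0=Q^2_{-1}=I$, $Q^1_{-1}=Q^2_0=0$ and $$-xQ^\alpha_n=Q^\alpha_{n+1}\lceil A_n\rceil+Q^\alpha_nT_n+Q^\alpha_{n-1}\lceil C_n\rceil\qquad(\alpha=1,2,\ n\in\mathbb Z).$$ Let $\breve L$ be the folded generator on $\mathbb Z_{\ge0}$, in which site $n$ carries the sites $n$ and $-n-1$ of $\mathbb Z$. It is the block tridiagonal operator with $2d^2\times2d^2$ blocks $\breve L_{n+1,n}=M_n$, $\breve L_{n,n}=D_n$, $\breve L_{n-1,n}=N_n$, where $$M_n=\begin{bmatrix}\lceil A_n\rceil&0\\0&\lceil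 C_{-n-1}\rceil\end{bmatrix}\ (n\ge0),\qquad N_n=\begin{bmatrix}\lceil C_n\rceil&0\\0&\lceil A_{-n-1}\rceil\end{bmatrix}\ (n\ge1),$$ $$D_0=\begin{bmatrix}T_0&\lceil A_{-1}\rceil\\\lceil C_0\rceil&T_{-1}\end{bmatrix},\qquad D_n=\begin{bmatrix}T_n&0\\0&T_{-n-1}\end{bmatrix}\ (n\ge1).$$ Let $\breve\Lambda_{ji}(t)$ be the blocks of $e^{t\breve L}$. Let $\mathcal Q_n$ ($n\ge0$) be the matrix polynomials with $\mathcal Q_0=I$, $\mathcal Q_{-1}=0$ and $-x\mathcal Q_n=\mathcal Q_{n+1}M_n+\mathcal Q_nD_n+\mathcal Q_{n-1}N_n$, and put $\breve\Pi_n=\mathrm{diag}(\Pi_n,\Pi_{-n-1})$. A *spectral block matrix* of the walk is a $2d^2\times2d^2$ positive semidefinite matrix of measures $W=\begin{bmatrix}W_{11}&W_{12}\\W_{21}&W_{22}\end{bmatrix}$ on $\mathbb R$ (each block of size $d^2\times d^2$) with finite moments such that $$\int_{\mathbb R}\mathcal Q_j^*(x)\,dW(x)\,\mathcal Q_i(x)=\delta_{ji}\,\breve\Pi_j^{-1}\qquad(i,j\ge0).$$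 Then: 1. A spectral block matrix $W$ exists. 2. For every spectral block matrix $W$, all $t\ge0$ and all $i,j\in\mathbb Z$, $$\Lambda_{ji}(t)=\sum_{\alpha,\beta=1}^{2}\Pi_j\int_{\mathbb R}e^{-xt}\,Q_j^{\alpha*}(x)\,dW_{\alpha\beta}(x)\,Q_i^{\beta}(x),$$ all the integrals being absolutely convergent. 3. Conversely, if a $2\times2$ block matrix $W=(W_{\alpha\beta})$ of complex measures on $\mathbb R$ satisfies the formula in 2 (with absolutely convergent integrals) for all $t\ge0$ and $i,j\in\mathbb Z$, then $$\breve\Lambda_{ji}(t)=\breve\Pi_j\int_{\mathbb R}e^{-xt}\mathcal Q_j^*(x)\,dW(x)\,\mathcal Q_i(x)\qquad(t\ge0,\ i,j\ge0),$$ again with absolutely convergent integrals. -/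

import Mathlib

open scoped Matrix Kronecker ComplexOrder

noncomputable section

namespace CTOQW

/-! ## Bounded block operators on `ℓ¹(V; ℂ^ι)` -/

/-- `ℓ¹(V; ℂ^ι)`. For `ι = Fin d × Fin d` the fibre is `vec (M_d(ℂ))`, and the space is that of the
(vectorized) block diagonal trace class operators `∑ ρ(i) ⊗ |i⟩⟨i|` on `⨁_{i ∈ V} ℂ^d` (on the
fibres the Hilbert-Schmidt norm is equivalent to the trace norm). -/
abbrev BlockSpace (V ι : Type) [Fintype ι] : Type :=
  lp (fun _ : V => EuclideanSpace ℂ ι) 1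

/-- A family of matrices with uniformly bounded entries. -/
def BddFamily {V m n : Type} (X : V → Matrix m n ℂ) : Prop :=
  ∃ c : ℝ, ∀ v a b, ‖X v a b‖ ≤ c

/-- The columns of the block matrix `K` are uniformly absolutely summable. -/
def ColBounded {V ι : Type} [Fintype ι] (K : V → V → Matrix ι ι ℂ) : Prop :=
  ∃ c : ℝ, ∀ (i : V) (s : Finset V), ∑ j ∈ s, ∑ a, ∑ b, ‖K j i a b‖ ≤ c

section BlockOp

variable {V ι : Type} [Fintype ι] [DecidableEq ι]

set_option linter.unusedSectionVars false

theorem norm_toEuclideanCLM_apply_le (A : Matrix ι ι ℂ) (v : EuclideanSpace ℂ ι) :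
    ‖Matrix.toEuclideanCLM (𝕜 := ℂ) A v‖ ≤ (∑ a, ∑ b, ‖A a b‖) * ‖v‖ := by
  have h1 : ∀ w : EuclideanSpace ℂ ι, ‖w‖ ≤ ∑ a, ‖w a‖ := by
    intro w
    rw [EuclideanSpace.norm_eq]
    apply Real.sqrt_le_iff.2
    refine ⟨Finset.sum_nonneg fun _ _ => norm_nonneg _, ?_⟩
    exact Finset.sum_sq_le_sq_sum_of_nonneg fun _ _ => norm_nonneg _
  refine (h1 _).trans ?_
  rw [Finset.sum_mul]
  refine Finset.sum_le_sum fun a _ => ?_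
  rw [Finset.sum_mul]
  have : (Matrix.toEuclideanCLM (𝕜 := ℂ) A v) a = ∑ b, A a b * v b := rfl
  rw [this]
  refine (norm_sum_le _ _).trans (Finset.sum_le_sum fun b _ => ?_)
  rw [norm_mul]
  exact mul_le_mul_of_nonneg_left (PiLp.norm_apply_le v b) (norm_nonneg _)

theorem ColBounded.summable_apply {K : V → V → Matrix ι ι ℂ} (hK : ColBounded K)
    (f : BlockSpace V ι) (j : V) :
    Summable fun i => (∑ a, ∑ b, ‖K j i a b‖) * ‖f i‖ := by
  obtain ⟨c, hc⟩ := hK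
  have hf : Summable fun i => ‖f i‖ := by simpa using (lp.memℓp f).summable (by simp)
  refine Summable.of_nonneg_of_le (fun i => by positivity) (fun i => ?_) (hf.mul_left c)
  exact mul_le_mul_of_nonneg_right (by simpa using hc i {j}) (norm_nonneg _)

theorem ColBounded.summable {K : V → V → Matrix ι ι ℂ} (hK : ColBounded K)
    (f : BlockSpace V ι) (j : V) :
    Summable fun i => Matrix.toEuclideanCLM (𝕜 := ℂ) (K j i) (f i) :=
  Summable.of_norm_bounded (hK.summable_apply f j) fun _ => norm_toEuclideanCLM_apply_le _ _

theorem ColBounded.sum_le {K : V → V → Matrix ι ι ℂ} {c : ℝ}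
    (hc : ∀ (i : V) (s : Finset V), ∑ j ∈ s, ∑ a, ∑ b, ‖K j i a b‖ ≤ c)
    (f : BlockSpace V ι) (s : Finset V) :
    ∑ j ∈ s, ‖∑' i, Matrix.toEuclideanCLM (𝕜 := ℂ) (K j i) (f i)‖ ≤ c * ‖f‖ := by
  have hK : ColBounded K := ⟨c, hc⟩
  have hf : Summable fun i => ‖f i‖ := by simpa using (lp.memℓp f).summable (by simp)
  calc ∑ j ∈ s, ‖∑' i, Matrix.toEuclideanCLM (𝕜 := ℂ) (K j i) (f i)‖
      ≤ ∑ j ∈ s, ∑' i, (∑ a, ∑ b, ‖K j i a b‖) * ‖f i‖ := by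
        refine Finset.sum_le_sum fun j _ => ?_
        exact tsum_of_norm_bounded (hK.summable_apply f j).hasSum
          fun _ => norm_toEuclideanCLM_apply_le _ _
    _ = ∑' i, ∑ j ∈ s, (∑ a, ∑ b, ‖K j i a b‖) * ‖f i‖ :=
        (Summable.tsum_finsetSum fun j _ => hK.summable_apply f j).symm
    _ ≤ ∑' i, c * ‖f i‖ := by
        refine Summable.tsum_le_tsum (fun i => ?_)
          (summable_sum fun j _ => hK.summable_apply f j) (hf.mul_left c)
        rw [← Finset.sum_mul]
        exact mul_le_mul_of_nonneg_right (hc i s) (norm_nonneg _)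
    _ = c * ‖f‖ := by
        rw [tsum_mul_left, lp.norm_eq_tsum_rpow (by simp)]
        simp

/-- The bounded operator on `ℓ¹(V; ℂ^ι)` with block matrix `K`: `(T f)_j = ∑_i K_{ji} f_i`. -/
def blockOp (K : V → V → Matrix ι ι ℂ) (hK : ColBounded K) :
    BlockSpace V ι →L[ℂ] BlockSpace V ι :=
  LinearMap.mkContinuousOfExistsBound
    { toFun := fun f =>
        ⟨fun j => ∑' i, Matrix.toEuclideanCLM (𝕜 := ℂ) (K j i) (f i), by
          obtain ⟨c, hc⟩ := hK
          exact memℓp_gen' (C := c * ‖f‖) fun s => by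
            simpa using ColBounded.sum_le hc f s⟩
      map_add' := fun f g => by
        ext1
        funext j
        change ∑' i, Matrix.toEuclideanCLM (𝕜 := ℂ) (K j i) ((f + g : BlockSpace V ι) i) = _ + _
        rw [← Summable.tsum_add (hK.summable f j) (hK.summable g j)]
        exact tsum_congr fun i => by
          rw [← map_add]; rfl
      map_smul' := fun z f => by
        ext1
        funext j
        change ∑' i, Matrix.toEuclideanCLM (𝕜 := ℂ) (K j i) ((z • f : BlockSpace V ι) i) = z • _
        rw [← (hK.summable f j).tsum_const_smul z]
        exact tsum_congr fun i => by
          rw [← map_smul]; rfl }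
    (by
      obtain ⟨c, hc⟩ := hK
      refine ⟨max c 0, fun f => ?_⟩
      refine lp.norm_le_of_forall_sum_le (by simp) (by positivity) fun s => ?_
      have h := ColBounded.sum_le hc f s
      have h2 : c * ‖f‖ ≤ max c 0 * ‖f‖ :=
        mul_le_mul_of_nonneg_right (le_max_left _ _) (norm_nonneg _)
      simpa using h.trans h2)

theorem blockOp_apply (K : V → V → Matrix ι ι ℂ) (hK : ColBounded K) (f : BlockSpace V ι)
    (j : V) : blockOp K hK f j = ∑' i, Matrix.toEuclideanCLM (𝕜 := ℂ) (K j i) (f i) := rfl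

/-- The block `T_{ji} ∈ M_ι(ℂ)` of an operator on `ℓ¹(V; ℂ^ι)`: its `b`-th column is the `j`-th
component of `T` applied to the `b`-th basis vector sitting at the site `i`. -/
def blockOf [DecidableEq V] (T : BlockSpace V ι →L[ℂ] BlockSpace V ι) (j i : V) :
    Matrix ι ι ℂ :=
  Matrix.of fun a b => (T (lp.single 1 i (EuclideanSpace.single b 1)) j) a

/-- A block matrix with uniformly bounded entries and at most `N` nonzero blocks in each column. -/
theorem ColBounded.of_banded {K : V → V → Matrix ι ι ℂ} {c : ℝ}
    (hc : ∀ j i a b, ‖K j i a b‖ ≤ c) (N : ℕ) (S : V → Finset V) (hS : ∀ i, (S i).card ≤ N)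
    (h0 : ∀ i j, j ∉ S i → K j i = 0) : ColBounded K := by
  classical
  refine ⟨N * (Fintype.card ι * (Fintype.card ι * max c 0)), fun i s => ?_⟩
  calc ∑ j ∈ s, ∑ a, ∑ b, ‖K j i a b‖
      ≤ ∑ j ∈ s ∪ S i, ∑ a, ∑ b, ‖K j i a b‖ :=
        Finset.sum_le_sum_of_subset_of_nonneg Finset.subset_union_left
          fun _ _ _ => Finset.sum_nonneg fun _ _ => Finset.sum_nonneg fun _ _ => norm_nonneg _
    _ = ∑ j ∈ S i, ∑ a, ∑ b, ‖K j i a b‖ := by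
        refine (Finset.sum_subset Finset.subset_union_right fun j _ hj => ?_).symm
        simp [h0 i j hj]
    _ ≤ ∑ j ∈ S i, (Fintype.card ι * (Fintype.card ι * max c 0)) := by
        refine Finset.sum_le_sum fun j _ => ?_
        calc ∑ a, ∑ b, ‖K j i a b‖ ≤ ∑ _a : ι, ∑ _b : ι, max c 0 :=
              Finset.sum_le_sum fun a _ => Finset.sum_le_sum fun b _ =>
                (hc j i a b).trans (le_max_left _ _)
          _ = _ := by simp
    _ = (S i).card * (Fintype.card ι * (Fintype.card ι * max c 0)) := by simp
    _ ≤ _ := by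
        have : ((S i).card : ℝ) ≤ N := by exact_mod_cast hS i
        exact mul_le_mul_of_nonneg_right this (by positivity)

end BlockOp

section BddFamily

variable {V m n k l : Type}

theorem BddFamily.add {X Y : V → Matrix m n ℂ} (hX : BddFamily X) (hY : BddFamily Y) :
    BddFamily fun v => X v + Y v := by
  obtain ⟨c, hc⟩ := hX
  obtain ⟨e, he⟩ := hY
  exact ⟨c + e, fun v a b => (norm_add_le _ _).trans (add_le_add (hc v a b) (he v a b))⟩

theorem BddFamily.smul {X : V → Matrix m n ℂ} (hX : BddFamily X) (z : ℂ) :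
    BddFamily fun v => z • X v := by
  obtain ⟨c, hc⟩ := hX
  refine ⟨‖z‖ * c, fun v a b => ?_⟩
  change ‖z • X v a b‖ ≤ _
  rw [norm_smul]
  exact mul_le_mul_of_nonneg_left (hc v a b) (norm_nonneg _)

theorem BddFamily.conjTranspose {X : V → Matrix m n ℂ} (hX : BddFamily X) :
    BddFamily fun v => (X v)ᴴ := by
  obtain ⟨c, hc⟩ := hX
  exact ⟨c, fun v a b => by simpa [Matrix.conjTranspose_apply] using hc v b a⟩

theorem BddFamily.conj {X : V → Matrix m n ℂ} (hX : BddFamily X) :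
    BddFamily fun v => (X v).map (starRingEnd ℂ) := by
  obtain ⟨c, hc⟩ := hX
  exact ⟨c, fun v a b => by simpa using hc v a b⟩

theorem BddFamily.mul [Fintype n] {X : V → Matrix m n ℂ} {Y : V → Matrix n k ℂ}
    (hX : BddFamily X) (hY : BddFamily Y) : BddFamily fun v => X v * Y v := by
  obtain ⟨c, hc⟩ := hX
  obtain ⟨e, he⟩ := hY
  refine ⟨∑ _j : n, c * e, fun v a b => ?_⟩
  change ‖(X v * Y v) a b‖ ≤ _
  rw [Matrix.mul_apply]
  refine (norm_sum_le _ _).trans (Finset.sum_le_sum fun j _ => ?_)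
  rw [norm_mul]
  exact mul_le_mul (hc v a j) (he v j b) (norm_nonneg _) ((norm_nonneg _).trans (hc v a j))

theorem BddFamily.kronecker {X : V → Matrix m n ℂ} {Y : V → Matrix k l ℂ}
    (hX : BddFamily X) (hY : BddFamily Y) : BddFamily fun v => X v ⊗ₖ Y v := by
  obtain ⟨c, hc⟩ := hX
  obtain ⟨e, he⟩ := hY
  refine ⟨c * e, fun v a b => ?_⟩
  change ‖X v a.1 b.1 * Y v a.2 b.2‖ ≤ _
  rw [norm_mul]
  exact mul_le_mul (hc v _ _) (he v _ _) (norm_nonneg _) ((norm_nonneg _).trans (hc v a.1 b.1))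

theorem BddFamily.const [Finite m] [Finite n] (A : Matrix m n ℂ) :
    BddFamily fun _ : V => A := by
  cases nonempty_fintype m
  cases nonempty_fintype n
  refine ⟨∑ a, ∑ b, ‖A a b‖, fun _ a b => ?_⟩
  exact (Finset.single_le_sum (f := fun b => ‖A a b‖) (fun _ _ => norm_nonneg _)
    (Finset.mem_univ b)).trans (Finset.single_le_sum (f := fun a => ∑ b, ‖A a b‖)
      (fun _ _ => Finset.sum_nonneg fun _ _ => norm_nonneg _) (Finset.mem_univ a))

theorem BddFamily.comp {U : Type} {X : V → Matrix m n ℂ} (hX : BddFamily X) (f : U → V) :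
    BddFamily fun u => X (f u) := by
  obtain ⟨c, hc⟩ := hX
  exact ⟨c, fun u a b => hc (f u) a b⟩

theorem BddFamily.fromBlocks {X : V → Matrix m n ℂ} {Y : V → Matrix m l ℂ}
    {Z : V → Matrix k n ℂ} {T : V → Matrix k l ℂ} (hX : BddFamily X) (hY : BddFamily Y)
    (hZ : BddFamily Z) (hT : BddFamily T) :
    BddFamily fun v => Matrix.fromBlocks (X v) (Y v) (Z v) (T v) := by
  obtain ⟨x, hx⟩ := hX
  obtain ⟨y, hy⟩ := hY
  obtain ⟨z, hz⟩ := hZ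
  obtain ⟨t, ht⟩ := hT
  refine ⟨max (max x y) (max z t), fun v a b => ?_⟩
  rcases a with a | a <;> rcases b with b | b <;>
    simp [hx v, hy v, hz v, ht v]

end BddFamily

/-! ## Nearest neighbour continuous-time open quantum walks on `ℤ` -/

/-- Entrywise complex conjugate `\overline{A}`. -/
def conjM {m : Type} (A : Matrix m m ℂ) : Matrix m m ℂ := A.map (starRingEnd ℂ)

/-- `⌈A⌉ = A ⊗ \overline{A}`, the matrix of `X ↦ A X A^*` under row-stacking `vec`. -/
def dbl {m : Type} (A : Matrix m m ℂ) : Matrix (m × m) (m × m) ℂ := A ⊗ₖ conjM A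

/-- The data of a tridiagonal CTOQW on `ℤ` with internal space `ℂ^d`: the transition operators
`A n : n → n + 1`, `B n : n → n`, `C n : n → n - 1`, and the local Hamiltonians `H n`. The four
sequences are bounded (that is, the operators of the Lindblad generator are bounded). -/
structure Walk (d : ℕ) where
  A : ℤ → Matrix (Fin d) (Fin d) ℂ
  B : ℤ → Matrix (Fin d) (Fin d) ℂ
  C : ℤ → Matrix (Fin d) (Fin d) ℂ
  H : ℤ → Matrix (Fin d) (Fin d) ℂ
  isHermitian_H : ∀ n, (H n).IsHermitian
  bddA : BddFamily A
  bddB : BddFamily B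
  bddC : BddFamily C
  bddH : BddFamily H

namespace Walk

variable {d : ℕ} (w : Walk d)

/-- `G_n = -i H_n - (1/2) ∑_j R_n^{j*} R_n^j`. -/
def G (n : ℤ) : Matrix (Fin d) (Fin d) ℂ :=
  (-Complex.I) • w.H n +
    (-(1 / 2 : ℂ)) • ((w.A n)ᴴ * w.A n + (w.B n)ᴴ * w.B n + (w.C n)ᴴ * w.C n)

/-- The diagonal block `G_n^α + ⌈B_n⌉`, with `G_n^α = G_n ⊗ I + I ⊗ \overline{G_n}`. -/
def diag (n : ℤ) : Matrix (Fin d × Fin d) (Fin d × Fin d) ℂ :=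
  (w.G n ⊗ₖ (1 : Matrix (Fin d) (Fin d) ℂ) + (1 : Matrix (Fin d) (Fin d) ℂ) ⊗ₖ conjM (w.G n)) +
    dbl (w.B n)

/-- The block matrix of the generator: column `i` has the block `⌈A_i⌉` in row `i + 1`, the block
`G_i^α + ⌈B_i⌉` in row `i` and the block `⌈C_i⌉` in row `i - 1`. -/
def gen (j i : ℤ) : Matrix (Fin d × Fin d) (Fin d × Fin d) ℂ :=
  if j = i + 1 then dbl (w.A i)
  else if j = i then w.diag i
  else if j = i - 1 then dbl (w.C i)
  else 0

/-- Blocks of the folded generator on `ℤ_{≥0}`; the site `n` carries the sites `n` and `-n-1`. -/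
def foldM (n : ℕ) : Matrix (Fin d × Fin d ⊕ Fin d × Fin d) (Fin d × Fin d ⊕ Fin d × Fin d) ℂ :=
  Matrix.fromBlocks (dbl (w.A n)) 0 0 (dbl (w.C (-(n : ℤ) - 1)))

/-- See `foldM`. -/
def foldD (n : ℕ) : Matrix (Fin d × Fin d ⊕ Fin d × Fin d) (Fin d × Fin d ⊕ Fin d × Fin d) ℂ :=
  if n = 0 then Matrix.fromBlocks (w.diag 0) (dbl (w.A (-1))) (dbl (w.C 0)) (w.diag (-1))
  else Matrix.fromBlocks (w.diag n) 0 0 (w.diag (-(n : ℤ) - 1))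

/-- See `foldM`; only used for `n ≥ 1`. -/
def foldN (n : ℕ) : Matrix (Fin d × Fin d ⊕ Fin d × Fin d) (Fin d × Fin d ⊕ Fin d × Fin d) ℂ :=
  Matrix.fromBlocks (dbl (w.C n)) 0 0 (dbl (w.A (-(n : ℤ) - 1)))

/-- The block matrix of the folded generator. -/
def foldGen (j i : ℕ) :
    Matrix (Fin d × Fin d ⊕ Fin d × Fin d) (Fin d × Fin d ⊕ Fin d × Fin d) ℂ :=
  if j = i + 1 then w.foldM i
  else if j = i then w.foldD i
  else if j + 1 = i then w.foldN i
  else 0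

theorem bdd_dbl {V : Type} {X : V → Matrix (Fin d) (Fin d) ℂ} (hX : BddFamily X) :
    BddFamily fun v => dbl (X v) := hX.kronecker hX.conj

theorem bdd_diag : BddFamily w.diag := by
  have hG : BddFamily w.G := (w.bddH.smul _).add
    ((((w.bddA.conjTranspose.mul w.bddA).add (w.bddB.conjTranspose.mul w.bddB)).add
      (w.bddC.conjTranspose.mul w.bddC)).smul _)
  exact ((hG.kronecker (.const _)).add ((BddFamily.const _).kronecker hG.conj)).add
    (bdd_dbl w.bddB)

theorem colBounded_gen : ColBounded w.gen := by
  obtain ⟨a, ha⟩ := bdd_dbl w.bddA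
  obtain ⟨b, hb⟩ := w.bdd_diag
  obtain ⟨c, hc⟩ := bdd_dbl w.bddC
  refine ColBounded.of_banded (c := max (max a b) (max c 0)) (fun j i x y => ?_) 3
    (fun i => {i + 1, i, i - 1}) (fun i => Finset.card_le_three) (fun i j hj => ?_)
  · unfold gen
    split_ifs
    · exact (ha _ _ _).trans (by simp)
    · exact (hb _ _ _).trans (by simp)
    · exact (hc _ _ _).trans (by simp)
    · simp
  · simp only [Finset.mem_insert, Finset.mem_singleton, not_or] at hj
    simp [gen, hj.1, hj.2.1, hj.2.2]

theorem colBounded_foldGen : ColBounded w.foldGen := by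
  obtain ⟨a, ha⟩ : BddFamily w.foldM :=
    .fromBlocks ((bdd_dbl w.bddA).comp _) (.const 0) (.const 0) ((bdd_dbl w.bddC).comp _)
  obtain ⟨b, hb⟩ : BddFamily (fun _ : ℕ => Matrix.fromBlocks (w.diag 0) (dbl (w.A (-1)))
      (dbl (w.C 0)) (w.diag (-1))) := .const _
  obtain ⟨b', hb'⟩ : BddFamily (fun n : ℕ => Matrix.fromBlocks (w.diag n) 0 0
      (w.diag (-(n : ℤ) - 1))) :=
    .fromBlocks (w.bdd_diag.comp _) (.const 0) (.const 0) (w.bdd_diag.comp _)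
  obtain ⟨c, hc⟩ : BddFamily w.foldN :=
    .fromBlocks ((bdd_dbl w.bddC).comp _) (.const 0) (.const 0) ((bdd_dbl w.bddA).comp _)
  refine ColBounded.of_banded (c := max (max a (max b b')) (max c 0)) (fun j i x y => ?_) 3
    (fun i => {i + 1, i, i - 1}) (fun i => Finset.card_le_three) (fun i j hj => ?_)
  · unfold foldGen foldD
    split_ifs
    · exact (ha _ _ _).trans (by simp)
    · exact (hb 0 _ _).trans (by simp)
    · exact (hb' _ _ _).trans (by simp)
    · exact (hc _ _ _).trans (by simp)
    · simp
  · simp only [Finset.mem_insert, Finset.mem_singleton, not_or] at hj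
    have : ¬ j + 1 = i := by omega
    simp [foldGen, hj.1, hj.2.1, this]

/-- `Λ_{ji}(t)`, the `(j,i)` block of the semigroup `e^{tL}` generated by the walk on `ℤ`. -/
def semigroup (t : ℝ) (j i : ℤ) : Matrix (Fin d × Fin d) (Fin d × Fin d) ℂ :=
  blockOf (NormedSpace.exp ((t : ℂ) • blockOp w.gen w.colBounded_gen)) j i

/-- The `(j,i)` block of the semigroup generated by the folded generator on `ℤ_{≥0}`. -/
def foldSemigroup (t : ℝ) (j i : ℕ) :
    Matrix (Fin d × Fin d ⊕ Fin d × Fin d) (Fin d × Fin d ⊕ Fin d × Fin d) ℂ :=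
  blockOf (NormedSpace.exp ((t : ℂ) • blockOp w.foldGen w.colBounded_foldGen)) j i

/-! ### The matrix-valued polynomials -/

/-- `(Q_{n-1}^α(x), Q_n^α(x))` for `n ≥ 0`; `α = 0, 1` stand for the superscripts `1, 2`. -/
def polyUp (α : Fin 2) (x : ℝ) : ℕ →
    Matrix (Fin d × Fin d) (Fin d × Fin d) ℂ × Matrix (Fin d × Fin d) (Fin d × Fin d) ℂ
  | 0 => if α = 0 then (0, 1) else (1, 0)
  | n + 1 =>
    let q := polyUp α x n
    (q.2, (-((x : ℂ) • q.2) - q.2 * w.diag n - q.1 * dbl (w.C n)) * (dbl (w.A n))⁻¹)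

/-- `(Q_{-n}^α(x), Q_{-n-1}^α(x))` for `n ≥ 0`. -/
def polyDown (α : Fin 2) (x : ℝ) : ℕ →
    Matrix (Fin d × Fin d) (Fin d × Fin d) ℂ × Matrix (Fin d × Fin d) (Fin d × Fin d) ℂ
  | 0 => if α = 0 then (1, 0) else (0, 1)
  | n + 1 =>
    let q := polyDown α x n
    (q.2, (-((x : ℂ) • q.2) - q.2 * w.diag (-(n : ℤ) - 1) - q.1 * dbl (w.A (-(n : ℤ) - 1))) *
      (dbl (w.C (-(n : ℤ) - 1)))⁻¹)

/-- The families `Q_n^α(x)`, `n ∈ ℤ`, with `Q_0^1 = I`, `Q_{-1}^1 = 0`, `Q_0^2 = 0`,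
`Q_{-1}^2 = I`, and the three-term recurrence of `poly_recurrence`. -/
def poly (α : Fin 2) (n : ℤ) (x : ℝ) : Matrix (Fin d × Fin d) (Fin d × Fin d) ℂ :=
  match n with
  | Int.ofNat k => (w.polyUp α x k).2
  | Int.negSucc k => (w.polyDown α x k).2

/-- The polynomials of the folded half-line walk: `𝒬_0 = I`, `𝒬_{-1} = 0` and
`-x 𝒬_n = 𝒬_{n+1} M_n + 𝒬_n D_n + 𝒬_{n-1} N_n` for `n ≥ 0`. -/
def foldPoly : ℕ → ℝ →
    Matrix (Fin d × Fin d ⊕ Fin d × Fin d) (Fin d × Fin d ⊕ Fin d × Fin d) ℂ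
  | 0, _ => 1
  | 1, x => (-((x : ℂ) • 1) - w.foldD 0) * (w.foldM 0)⁻¹
  | n + 2, x =>
    (-((x : ℂ) • foldPoly (n + 1) x) - foldPoly (n + 1) x * w.foldD (n + 1) -
      foldPoly n x * w.foldN (n + 1)) * (w.foldM (n + 1))⁻¹

theorem isUnit_det_dbl {A : Matrix (Fin d) (Fin d) ℂ} (hA : IsUnit A.det) :
    IsUnit (dbl A).det := by
  have h : (conjM A).det = starRingEnd ℂ A.det := (RingHom.map_det (starRingEnd ℂ) A).symm
  rw [dbl, Matrix.det_kronecker, h]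
  exact (hA.pow _).mul ((hA.map _).pow _)

theorem poly_recurrence (hA : ∀ n : ℤ, 0 ≤ n → IsUnit (w.A n).det)
    (hC : ∀ n : ℤ, n ≤ -1 → IsUnit (w.C n).det) (α : Fin 2) (n : ℤ) (x : ℝ) :
    -((x : ℂ) • w.poly α n x) = w.poly α (n + 1) x * dbl (w.A n) + w.poly α n x * w.diag n +
      w.poly α (n - 1) x * dbl (w.C n) := by
  have hup : ∀ k : ℕ, (w.polyUp α x k).2 = w.poly α k x := fun _ => rfl
  have hdn : ∀ k : ℕ, (w.polyDown α x k).2 = w.poly α (-(k : ℤ) - 1) x := fun k => by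
    rw [show -(k : ℤ) - 1 = Int.negSucc k by rw [Int.negSucc_eq]; ring]; rfl
  have hup1 : ∀ k : ℕ, (w.polyUp α x k).1 = w.poly α ((k : ℤ) - 1) x := by
    rintro (_ | k)
    · fin_cases α <;> rfl
    · simp only [polyUp, hup]; push_cast; ring_nf
  have hdn1 : ∀ k : ℕ, (w.polyDown α x k).1 = w.poly α (-(k : ℤ)) x := by
    rintro (_ | k)
    · fin_cases α <;> simp [polyUp, poly, polyDown]
    · simp only [polyDown, hdn]; push_cast; ring_nf
  rcases le_or_gt 0 n with hn | hn
  · obtain ⟨k, rfl⟩ := Int.eq_ofNat_of_zero_le hn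
    have h := hup (k + 1)
    simp only [polyUp, hup, hup1] at h
    push_cast at h
    rw [← h, Matrix.mul_assoc, Matrix.nonsing_inv_mul _ (isUnit_det_dbl (hA _ hn)),
      Matrix.mul_one]
    abel
  · obtain ⟨k, rfl⟩ : ∃ k : ℕ, n = -(k : ℤ) - 1 := ⟨(-n - 1).toNat, by omega⟩
    have h := hdn (k + 1)
    simp only [polyDown, hdn, hdn1] at h
    rw [show -((k + 1 : ℕ) : ℤ) - 1 = -(k : ℤ) - 1 - 1 by push_cast; ring] at h
    rw [← h, Matrix.mul_assoc _ _ (dbl (w.C _)),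
      Matrix.nonsing_inv_mul _ (isUnit_det_dbl (hC _ (by omega))), Matrix.mul_one,
      show -(k : ℤ) - 1 + 1 = -(k : ℤ) by ring]
    abel

end Walk

/-! ## Matrix measures on `ℝ` -/

/-- A square matrix of complex measures on `ℝ`. -/
abbrev MatrixMeasure (κ : Type) : Type := κ → κ → MeasureTheory.ComplexMeasure ℝ

/-- A weight matrix: a positive semidefinite matrix of measures with finite moments. -/
structure IsWeight {κ : Type} (W : MatrixMeasure κ) : Prop where
  posSemidef : ∀ s : Set ℝ, MeasurableSet s → (Matrix.of fun k l => W k l s).PosSemidef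
  moments : ∀ k l, ∀ n : ℕ, (W k l).Integrable fun x : ℝ => (x : ℂ) ^ n

/-- All entries of `φ(x) P^*(x) dU(x) Q(x)` are integrable. -/
def SandwichIntegrable {κ : Type} (U : MatrixMeasure κ) (φ : ℝ → ℂ) (P Q : ℝ → Matrix κ κ ℂ) :
    Prop :=
  ∀ a b k l, (U k l).Integrable fun x => φ x * star (P x k a) * Q x l b

/-- The matrix `∫_ℝ φ(x) P^*(x) dU(x) Q(x)`. -/
def sandwich {κ : Type} [Fintype κ] (U : MatrixMeasure κ) (φ : ℝ → ℂ)
    (P Q : ℝ → Matrix κ κ ℂ) : Matrix κ κ ℂ :=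
  Matrix.of fun a b => ∑ k, ∑ l,
    (U k l).integral (fun x => φ x * star (P x k a) * Q x l b) (ContinuousLinearMap.mul ℝ ℂ)

/-- The block `W_{αβ}` of a `2 × 2` block matrix of measures. -/
def measBlock {κ : Type} (W : MatrixMeasure (κ ⊕ κ)) (α β : Fin 2) : MatrixMeasure κ :=
  fun k l => W (if α = 0 then Sum.inl k else Sum.inr k) (if β = 0 then Sum.inl l else Sum.inr l)

namespace Walk

variable {d : ℕ} (w : Walk d)

/-- `Π_j = (R_j^* R_j)⁻¹`. -/
def invGram (R : ℤ → Matrix (Fin d × Fin d) (Fin d × Fin d) ℂ) (j : ℤ) :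
    Matrix (Fin d × Fin d) (Fin d × Fin d) ℂ :=
  ((R j)ᴴ * R j)⁻¹

/-- `\breve Π_j = diag(Π_j, Π_{-j-1})`. -/
def foldInvGram (R : ℤ → Matrix (Fin d × Fin d) (Fin d × Fin d) ℂ) (j : ℕ) :
    Matrix (Fin d × Fin d ⊕ Fin d × Fin d) (Fin d × Fin d ⊕ Fin d × Fin d) ℂ :=
  Matrix.fromBlocks (invGram R j) 0 0 (invGram R (-(j : ℤ) - 1))

/-- `W` is a spectral block matrix of the walk: a weight matrix for which the polynomials of the
folded half-line walk are orthogonal, with `\breve Π_j = (∫ 𝒬_j^* dW 𝒬_j)⁻¹`. -/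
structure IsSpectral (R : ℤ → Matrix (Fin d × Fin d) (Fin d × Fin d) ℂ)
    (W : MatrixMeasure (Fin d × Fin d ⊕ Fin d × Fin d)) : Prop where
  isWeight : IsWeight W
  orthogonal : ∀ j i : ℕ, sandwich W (fun _ => 1) (w.foldPoly j) (w.foldPoly i) =
    if j = i then (foldInvGram R j)⁻¹ else 0

/-- Karlin-McGregor formula for the walk on `ℤ`:
`Λ_{ji}(t) = ∑_{α,β} Π_j ∫ e^{-xt} Q_j^{α*}(x) dW_{αβ}(x) Q_i^β(x)`, with convergent integrals. -/
def KarlinMcGregor (R : ℤ → Matrix (Fin d × Fin d) (Fin d × Fin d) ℂ)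
    (W : MatrixMeasure (Fin d × Fin d ⊕ Fin d × Fin d)) : Prop :=
  ∀ t : ℝ, 0 ≤ t → ∀ j i : ℤ,
    (∀ α β : Fin 2, SandwichIntegrable (measBlock W α β) (fun x => Complex.exp (-(x * t)))
      (w.poly α j) (w.poly β i)) ∧
    w.semigroup t j i = ∑ α : Fin 2, ∑ β : Fin 2, invGram R j *
      sandwich (measBlock W α β) (fun x => Complex.exp (-(x * t))) (w.poly α j) (w.poly β i)

/-- Karlin-McGregor formula for the folded walk on `ℤ_{≥0}`:
`\breve Λ_{ji}(t) = \breve Π_j ∫ e^{-xt} 𝒬_j^*(x) dW(x) 𝒬_i(x)`, with convergent integrals. -/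
def FoldKarlinMcGregor (R : ℤ → Matrix (Fin d × Fin d) (Fin d × Fin d) ℂ)
    (W : MatrixMeasure (Fin d × Fin d ⊕ Fin d × Fin d)) : Prop :=
  ∀ t : ℝ, 0 ≤ t → ∀ j i : ℕ,
    SandwichIntegrable W (fun x => Complex.exp (-(x * t))) (w.foldPoly j) (w.foldPoly i) ∧
    w.foldSemigroup t j i = foldInvGram R j *
      sandwich W (fun x => Complex.exp (-(x * t))) (w.foldPoly j) (w.foldPoly i)

end Walk

end CTOQW

end

/-!
The conditions on `R_n` say that the generator `L` is symmetric for the weighted `ℓ²` form with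
Gram matrices `R_n^* R_n` (`CTOQW.Walk.gram_mul_gen`). They give no bound for `L` in this form, but
`L` is bounded on `ℓ¹`, and finitely supported vectors are bounded functionals on `ℓ¹`, so the
moments `⟪f, Lⁿ f⟫` grow at most geometrically (`CTOQW.inner_finOp_growth`). For a symmetric
operator this growth already implies boundedness, by log-convexity of `n ↦ ‖Lⁿ f‖`
(`CTOQW.norm_apply_le_of_growth`). Hence `-L` extends to a bounded self-adjoint operator of the
weighted `ℓ²` space, and the spectral theorem, obtained from the continuous functional calculus,
the Riesz-Markov-Kakutani theorem and polarization (`CTOQW.exists_matrixMeasure_inner`), gives a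
positive semidefinite matrix of measures `W` whose moments are those of `-L` at the sites `0` and
`-1`.

The rows of `Q^1` and `Q^2` are left eigenvectors of `L` for the eigenvalue `-x`. Therefore the
integrals `∫ xⁿ [Q_j^1; Q_j^2]^* dW [Q_i^1; Q_i^2]` and the blocks `Π_j⁻¹ ((-L)ⁿ)_{ji}` satisfy the
same three-term recurrences in `i` and in `j`. They agree at the sites `0` and `-1`, and the
nonsingularity of `A_n` for `n ≥ 0` and of `C_n` for `n ≤ -1` propagates the equality to all of `ℤ`
(`CTOQW.Walk.eq_zero_of_recurrence`). The case `n = 0` is the orthogonality of the block columns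
`[Q_n^1; Q_n^2]` (`CTOQW.Walk.exists_isWeight_orthogonal`). As `𝒬_n` consists of the block columns
of the sites `n` and `-n-1` (`CTOQW.Walk.foldPoly_eq`), this is the same as orthogonality of the
`𝒬_n`, so `W` is a spectral block matrix.

For an arbitrary spectral block matrix, orthogonality and the eigenvector relation express all
moments through blocks of powers of a generator bounded on `ℓ¹`
(`CTOQW.IsEigenRow.pairing_pow`). The moments thus grow geometrically, so the measures have compact
support (`CTOQW.IsWeight.bddSupport`) and the exponential series may be integrated termwise
(`CTOQW.IsEigenRow.pairing_exp`). This argument applies both to the walk and to the folded walk.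

For the converse, the formula on `ℤ` determines all the integrals
`∫ e^{-xt} [Q_j^1; Q_j^2]^* dW [Q_i^1; Q_i^2]`, hence the folded integrals. They are those of a
spectral block matrix, for which the folded formula has just been proved
(`CTOQW.Walk.KarlinMcGregor.fold`).
-/

noncomputable section

namespace CTOQW

open MeasureTheory Filter Topology

/-! ### Integration against complex measures -/

/-- The integral `∫ f dν` of a complex function against a complex measure, as it appears in
`sandwich`. -/
abbrev cint (ν : ComplexMeasure ℝ) (f : ℝ → ℂ) : ℂ :=
  ν.integral f (ContinuousLinearMap.mul ℝ ℂ)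

theorem cint_const_mul (ν : ComplexMeasure ℝ) (c : ℂ) (f : ℝ → ℂ) :
    cint ν (fun x => c * f x) = c * cint ν f := by
  unfold cint
  rw [VectorMeasure.integral_eq_setToFun, VectorMeasure.integral_eq_setToFun]
  refine setToFun_smul (𝕜 := ℂ) _ (fun c s x => ?_) c f
  change c * x * ν s = c * (x * ν s)
  ring

theorem norm_cint_le (ν : ComplexMeasure ℝ) (f : ℝ → ℂ) :
    ‖cint ν f‖ ≤ ‖ContinuousLinearMap.mul ℝ ℂ‖ * ∫ x, ‖f x‖ ∂ν.variation :=
  VectorMeasure.norm_integral_le_integral_norm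

section Density

variable {ν : ComplexMeasure ℝ} {ρ : Measure ℝ} {a : ℂ}

theorem variation_le_of_apply_eq [IsFiniteMeasure ρ]
    (h : ∀ s, MeasurableSet s → ν s = a * (ρ.real s : ℂ)) : ν.variation ≤ ‖a‖₊ • ρ := by
  refine VectorMeasure.variation_le_of_forall_enorm_le fun s hs => ?_
  rw [h s hs, enorm_mul]
  refine le_of_eq ?_
  rw [Measure.smul_apply, ENNReal.smul_def, smul_eq_mul, enorm_eq_nnnorm]
  congr 1
  rw [← ofReal_norm, Complex.norm_real, Real.norm_of_nonneg measureReal_nonneg,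
    ofReal_measureReal]

theorem cint_eq_of_apply_eq [IsFiniteMeasure ρ]
    (h : ∀ s, MeasurableSet s → ν s = a * (ρ.real s : ℂ)) {f : ℝ → ℂ} (hf : Integrable f ρ) :
    ν.Integrable f ∧ cint ν f = a * ∫ x, f x ∂ρ := by
  have hle := variation_le_of_apply_eq h
  have hint : ∀ {g : ℝ → ℂ}, Integrable g ρ → ν.Integrable g := fun hg =>
    (hg.smul_measure_nnreal).mono_measure hle
  have hfin : IsFiniteMeasure ν.variation := isFiniteMeasure_of_le _ hle
  refine ⟨hint hf, ?_⟩
  refine Integrable.induction (fun f => cint ν f = a * ∫ x, f x ∂ρ) ?_ ?_ ?_ ?_ hf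
  · intro c s hs _
    unfold cint
    rw [VectorMeasure.integral_eq_setToFun, setToFun_indicator_const _ hs (measure_ne_top _ _),
      integral_indicator_const _ hs]
    change c * ν s = _
    rw [h s hs, Complex.real_smul]
    ring
  · intro f g _ hf hg h1 h2
    have e1 : cint ν (f + g) = cint ν f + cint ν g :=
      VectorMeasure.integral_add (hint hf) (hint hg)
    change cint ν (f + g) = _
    rw [e1, h1, h2, integral_add' hf hg]
    ring
  · refine isClosed_eq ?_ (continuous_const.mul continuous_integral)
    -- `cint ν` is Lipschitz for the norm of `L¹(ρ)`, because `|ν| ≤ ‖a‖ ρ`.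
    refine (LipschitzWith.of_dist_le_mul (K := ‖ContinuousLinearMap.mul ℝ ℂ‖₊ * ‖a‖₊)
      fun f g => ?_).continuous
    have hfi := L1.integrable_coeFn f
    have hgi := L1.integrable_coeFn g
    have e1 : cint ν f - cint ν g = cint ν (fun x => f x - g x) :=
      (VectorMeasure.integral_fun_sub (hint hfi) (hint hgi)).symm
    rw [dist_eq_norm, e1, dist_eq_norm, L1.norm_eq_integral_norm, NNReal.coe_mul, mul_assoc]
    refine (norm_cint_le _ _).trans ?_
    refine mul_le_mul_of_nonneg_left ?_ (NNReal.coe_nonneg ‖ContinuousLinearMap.mul ℝ ℂ‖₊)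
    calc ∫ x, ‖f x - g x‖ ∂ν.variation ≤ ∫ x, ‖f x - g x‖ ∂(‖a‖₊ • ρ) :=
          integral_mono_measure hle (ae_of_all _ fun _ => norm_nonneg _)
            ((hfi.sub hgi).smul_measure_nnreal).norm
      _ = ‖a‖ * ∫ x, ‖f x - g x‖ ∂ρ := by
          rw [integral_smul_nnreal_measure]; rfl
      _ = ‖a‖ * ∫ x, ‖(f - g) x‖ ∂ρ := by
          congr 1
          refine integral_congr_ae ?_
          filter_upwards [Lp.coeFn_sub f g] with x hx
          rw [hx]; rfl
  · intro f g hfg hf h1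
    rw [← integral_congr_ae hfg, ← h1]
    have hac : ν.variation ≪ ρ := Measure.absolutelyContinuous_of_le_smul hle
    exact VectorMeasure.integral_congr_ae (hac hfg.symm)

end Density

/-- The complex measure `∑ᵢ aᵢ ρᵢ`. -/
def comboMeasure {σ : Type} [Fintype σ] (a : σ → ℂ) (ρ : σ → Measure ℝ)
    [∀ i, IsFiniteMeasure (ρ i)] : ComplexMeasure ℝ :=
  ∑ i, a i • (ρ i).toSignedMeasure.toComplexMeasure 0

section Combo

variable {σ : Type} (a : σ → ℂ) (ρ : σ → Measure ℝ) [∀ i, IsFiniteMeasure (ρ i)]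

theorem smul_toComplexMeasure_apply (i : σ) {s : Set ℝ} (hs : MeasurableSet s) :
    (a i • (ρ i).toSignedMeasure.toComplexMeasure 0) s = a i * ((ρ i).real s : ℂ) := by
  rw [smul_apply, SignedMeasure.toComplexMeasure_apply, smul_eq_mul,
    Measure.toSignedMeasure_apply_measurable hs]
  rfl

variable [Fintype σ]

theorem comboMeasure_apply {s : Set ℝ} (hs : MeasurableSet s) :
    comboMeasure a ρ s = ∑ i, a i * ((ρ i).real s : ℂ) := by
  rw [comboMeasure, FunLike.coe_sum, Finset.sum_apply]
  exact Finset.sum_congr rfl fun i _ => smul_toComplexMeasure_apply a ρ i hs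

theorem variation_comboMeasure_le :
    (comboMeasure a ρ).variation ≤ ∑ i, ‖a i‖₊ • ρ i :=
  (VectorMeasure.variation_finsetSum_le _ _).trans
    (Finset.sum_le_sum fun i _ => variation_le_of_apply_eq fun _ hs =>
      smul_toComplexMeasure_apply a ρ i hs)

theorem cint_comboMeasure {f : ℝ → ℂ} (hf : ∀ i, Integrable f (ρ i)) :
    cint (comboMeasure a ρ) f = ∑ i, a i * ∫ x, f x ∂(ρ i) := by
  have h := fun i => cint_eq_of_apply_eq
    (fun _ hs => smul_toComplexMeasure_apply a ρ i hs) (hf i)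
  exact (VectorMeasure.integral_finsetSum_vectorMeasure fun i _ => (h i).1).trans
    (Finset.sum_congr rfl fun i _ => (h i).2)

end Combo

/-- A complex linear relation between the integrals of finite measures against all bounded
continuous functions holds between the measures themselves. -/
theorem sum_measureReal_eq_zero {σ : Type} [Fintype σ] (a : σ → ℂ) (ρ : σ → Measure ℝ)
    [∀ i, IsFiniteMeasure (ρ i)]
    (h : ∀ f : BoundedContinuousFunction ℝ ℝ, ∑ i, a i * ((∫ x, f x ∂(ρ i) : ℝ) : ℂ) = 0)
    (s : Set ℝ) : ∑ i, a i * ((ρ i).real s : ℂ) = 0 := by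
  have key : ∀ b : σ → ℝ, (∀ f : BoundedContinuousFunction ℝ ℝ, ∑ i, b i * ∫ x, f x ∂(ρ i) = 0) →
      ∑ i, b i * (ρ i).real s = 0 := by
    intro b hb
    -- Separate the terms with positive coefficients from the others.
    have h1 : ∑ i, (b i).toNNReal • ρ i = ∑ i, (-b i).toNNReal • ρ i := by
      refine ext_of_forall_integral_eq_of_IsFiniteMeasure fun f => ?_
      have hi : ∀ (c : σ → NNReal) (i : σ), i ∈ Finset.univ → Integrable f (c i • ρ i) :=
        fun c i _ => (f.integrable (ρ i)).smul_measure_nnreal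
      rw [integral_finsetSum_measure (hi _), integral_finsetSum_measure (hi _),
        ← sub_eq_zero, ← Finset.sum_sub_distrib, ← hb f]
      refine Finset.sum_congr rfl fun i _ => ?_
      rw [integral_smul_nnreal_measure, integral_smul_nnreal_measure, NNReal.smul_def,
        NNReal.smul_def, ← sub_smul, Real.coe_toNNReal', Real.coe_toNNReal',
        max_zero_sub_max_neg_zero_eq_self, smul_eq_mul]
    have h2 := congrArg (fun μ : Measure ℝ => μ.real s) h1
    simp only [measureReal_def, Measure.coe_finsetSum, Finset.sum_apply] at h2
    rw [ENNReal.toReal_sum fun i _ => measure_ne_top _ _,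
      ENNReal.toReal_sum fun i _ => measure_ne_top _ _, ← sub_eq_zero,
      ← Finset.sum_sub_distrib] at h2
    rw [← h2]
    refine Finset.sum_congr rfl fun i _ => ?_
    simp only [Measure.smul_apply, ENNReal.smul_def, smul_eq_mul, ENNReal.toReal_mul,
      ENNReal.coe_toReal]
    rw [← sub_mul, Real.coe_toNNReal', Real.coe_toNNReal', max_zero_sub_max_neg_zero_eq_self]
    rfl
  refine Complex.ext ?_ ?_
  · have := key (fun i => (a i).re) fun f => by
      simpa using congrArg Complex.re (h f)
    simpa using this
  · have := key (fun i => (a i).im) fun f => by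
      simpa using congrArg Complex.im (h f)
    simpa using this

/-- A complex measure with nonnegative values is a finite positive measure. -/
theorem exists_measure_of_nonneg {ν : ComplexMeasure ℝ} (h : ∀ s, MeasurableSet s → 0 ≤ ν s) :
    ∃ ρ : Measure ℝ, IsFiniteMeasure ρ ∧ ∀ s, MeasurableSet s → ν s = (ρ.real s : ℂ) := by
  have hre : 0 ≤[Set.univ] ComplexMeasure.re ν := by
    intro s hs
    rw [VectorMeasure.restrict_univ, VectorMeasure.restrict_univ]
    exact (Complex.le_def.1 (h s hs)).1
  refine ⟨(ComplexMeasure.re ν).toMeasureOfZeroLE Set.univ .univ hre, inferInstance,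
    fun s hs => ?_⟩
  rw [SignedMeasure.toMeasureOfZeroLE_real_apply _ hre .univ hs, Set.univ_inter]
  exact Complex.ext rfl (by simpa using (Complex.le_def.1 (h s hs)).2.symm)

/-! ### Compactly supported matrix measures -/

/-- A complex measure of finite variation that vanishes outside a bounded set. -/
def BddSupport (ν : ComplexMeasure ℝ) : Prop :=
  IsFiniteMeasure ν.variation ∧ ∃ M : ℝ, ν.variation {x | M < |x|} = 0

theorem exists_bound_of_abs_le {f : ℝ → ℂ} (hf : Continuous f) (M : ℝ) :
    ∃ c, ∀ x, |x| ≤ M → ‖f x‖ ≤ c := by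
  obtain ⟨c, hc⟩ := (isCompact_Icc (a := -M) (b := M)).exists_bound_of_continuousOn hf.continuousOn
  exact ⟨c, fun x hx => hc x (abs_le.1 hx)⟩

theorem BddSupport.integrable {ν : ComplexMeasure ℝ} (hν : BddSupport ν) {f : ℝ → ℂ}
    (hf : Continuous f) : ν.Integrable f := by
  obtain ⟨hfin, M, hM⟩ := hν
  obtain ⟨c, hc⟩ := exists_bound_of_abs_le hf M
  refine Integrable.of_bound hf.aestronglyMeasurable c ?_
  have : ∀ᵐ x ∂ν.variation, ¬ M < |x| := measure_eq_zero_iff_ae_notMem.1 hM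
  filter_upwards [this] with x hx using hc x (not_lt.1 hx)

/-- If the even moments of the diagonal entries of a weight matrix grow at most geometrically, then
all its entries have bounded support. -/
theorem IsWeight.bddSupport {κ : Type} [Fintype κ] [DecidableEq κ] {W : MatrixMeasure κ}
    (hW : IsWeight W) {M C : ℝ} (hM : 0 ≤ M)
    (h : ∀ k n, ‖cint (W k k) (fun x => (x : ℂ) ^ (2 * n))‖ ≤ C * M ^ (2 * n)) (k l : κ) :
    BddSupport (W k l) := by
  have hnn : ∀ k s, MeasurableSet s → 0 ≤ W k k s := fun k s hs =>
    (hW.posSemidef s hs).diag_nonneg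
  refine ⟨?_, M + 1, ?_⟩
  · have h0 := hW.moments k l 0
    simp only [pow_zero] at h0
    exact (integrable_const_iff_isFiniteMeasure one_ne_zero).1 h0
  have hs : MeasurableSet {x : ℝ | M + 1 < |x|} :=
    measurableSet_lt measurable_const measurable_norm
  have hdiag : W k k {x | M + 1 < |x|} = 0 := by
    obtain ⟨ρ, hρ, hνρ⟩ := exists_measure_of_nonneg (hnn k)
    have hle : ρ ≤ (W k k).variation := by
      refine Measure.le_iff.2 fun s hs => ?_
      refine le_trans (le_of_eq ?_) (VectorMeasure.enorm_measure_le_variation _ s)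
      rw [hνρ s hs, ← ofReal_norm, Complex.norm_real, Real.norm_of_nonneg measureReal_nonneg,
        ofReal_measureReal]
    have hint : ∀ n, Integrable (fun x : ℝ => x ^ (2 * n)) ρ := fun n => by
      have h1 : Integrable (fun x : ℝ => (x : ℂ) ^ (2 * n)) ρ :=
        Integrable.mono_measure (hW.moments k k (2 * n)) hle
      simpa [← Complex.ofReal_pow] using h1.re
    have hbd : ∀ n : ℕ, ρ.real {x | M + 1 < |x|} ≤ C * (M / (M + 1)) ^ (2 * n) := by
      intro n
      have h1 : cint (W k k) (fun x => (x : ℂ) ^ (2 * n)) = ((∫ x, x ^ (2 * n) ∂ρ : ℝ) : ℂ) := by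
        have h2 : Integrable (fun x : ℝ => (x : ℂ) ^ (2 * n)) ρ := by
          simpa using (hint n).ofReal (𝕜 := ℂ)
        rw [(cint_eq_of_apply_eq (a := 1) (fun s hs => by rw [hνρ s hs, one_mul]) h2).2, one_mul]
        simpa using integral_ofReal (𝕜 := ℂ) (μ := ρ) (f := fun x : ℝ => x ^ (2 * n))
      have h2 := h k n
      rw [h1, Complex.norm_real] at h2
      have h3 := mul_meas_ge_le_integral_of_nonneg (μ := ρ) (f := fun x : ℝ => x ^ (2 * n))
        (ae_of_all _ fun x => (even_two_mul n).pow_nonneg x) (hint n) ((M + 1) ^ (2 * n))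
      have h4 : ρ.real {x | M + 1 < |x|} ≤ ρ.real {x | (M + 1) ^ (2 * n) ≤ x ^ (2 * n)} := by
        refine measureReal_mono fun x hx => ?_
        have hx' : M + 1 < |x| := hx
        change (M + 1) ^ (2 * n) ≤ x ^ (2 * n)
        rw [← (even_two_mul n).pow_abs x]
        exact pow_le_pow_left₀ (by linarith) hx'.le _
      have h5 : 0 < (M + 1) ^ (2 * n) := by positivity
      rw [div_pow, mul_div_assoc', le_div_iff₀ h5, mul_comm]
      exact (mul_le_mul_of_nonneg_left h4 h5.le).trans
        (h3.trans ((le_abs_self _).trans h2))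
    have hlim : Tendsto (fun n : ℕ => C * (M / (M + 1)) ^ (2 * n)) atTop (𝓝 (C * 0)) := by
      refine Tendsto.const_mul _ ?_
      have h1 : M / (M + 1) < 1 := (div_lt_one (by linarith)).2 (by linarith)
      exact (tendsto_pow_atTop_nhds_zero_of_lt_one (by positivity) h1).comp
        (tendsto_id.const_mul_atTop' two_pos)
    have h0 := ge_of_tendsto' hlim hbd
    rw [mul_zero] at h0
    rw [hνρ _ hs, le_antisymm h0 measureReal_nonneg]
    rfl
  -- A zero diagonal entry of a positive semidefinite matrix forces its row to vanish.
  rw [VectorMeasure.variation_apply_eq_zero hs]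
  intro t hts ht
  have hkk : W k k t = 0 := by
    obtain ⟨ρ, hρ, hνρ⟩ := exists_measure_of_nonneg (hnn k)
    have h1 : ρ.real {x | M + 1 < |x|} = 0 := by
      have := hνρ _ hs
      rw [hdiag] at this
      exact_mod_cast this.symm
    rw [hνρ t ht, le_antisymm ((measureReal_mono hts).trans h1.le) measureReal_nonneg]
    rfl
  have hA := hW.posSemidef t ht
  have h1 := (hA.dotProduct_mulVec_zero_iff (Pi.single k 1)).1 (by
    simpa [Matrix.mulVec_single_one] using hkk)
  have h2 : W l k t = 0 := by
    simpa [Matrix.mulVec_single_one] using congrFun h1 l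
  have h3 := hA.isHermitian.apply k l
  simp only [Matrix.of_apply] at h3
  rw [← h3, h2, star_zero]

/-! ### Matrix-valued spectral measures of bounded self-adjoint operators -/

section Spectral

open scoped InnerProductSpace

variable {H : Type*} [NormedAddCommGroup H] [InnerProductSpace ℂ H] [CompleteSpace H]

/-- The spectral measure of a self-adjoint operator `S` at a vector `v`: Riesz-Markov-Kakutani
applied to `f ↦ ⟪v, f(S) v⟫`. -/
theorem exists_spectralMeasure {S : H →L[ℂ] H} (hS : IsSelfAdjoint S) (v : H) :
    ∃ ρ : Measure ℝ, IsFiniteMeasure ρ ∧ ρ (spectrum ℝ S)ᶜ = 0 ∧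
      ∀ f : ℝ → ℝ, Continuous f → ((∫ x, f x ∂ρ : ℝ) : ℂ) = ⟪v, cfc f S v⟫_ℂ := by
  have hX : IsCompact (spectrum ℝ S) := ContinuousFunctionalCalculus.isCompact_spectrum S
  have : CompactSpace (spectrum ℝ S) := isCompact_iff_compactSpace.1 hX
  let φ := cfcHom (R := ℝ) hS
  have hφ : ∀ f, IsSelfAdjoint (φ f) := fun f => cfcHom_predicate hS f
  have hsymm : ∀ f, (φ f : H →ₗ[ℂ] H).IsSymmetric := fun f =>
    ContinuousLinearMap.isSelfAdjoint_iff_isSymmetric.1 (hφ f)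
  have hreal : ∀ f, ((⟪v, φ f v⟫_ℂ).re : ℂ) = ⟪v, φ f v⟫_ℂ := fun f =>
    (hsymm f).coe_re_inner_self_apply v
  let Λ₀ : CompactlySupportedContinuousMap (spectrum ℝ S) ℝ →ₗ[ℝ] ℝ :=
    { toFun := fun f => (⟪v, φ f.toContinuousMap v⟫_ℂ).re
      map_add' := fun f g => by
        change (⟪v, φ (f.toContinuousMap + g.toContinuousMap) v⟫_ℂ).re = _
        simp
      map_smul' := fun c f => by
        change (⟪v, φ (c • f.toContinuousMap) v⟫_ℂ).re = _
        rw [map_smul, smul_apply, ← Complex.coe_smul, inner_smul_right]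
        simp }
  have hpos : ∀ f, 0 ≤ f → 0 ≤ Λ₀ f := by
    intro f hf
    let g : C(spectrum ℝ S, ℝ) := ⟨fun x => √(f x), by fun_prop⟩
    have hg : f.toContinuousMap = g * g := by
      ext x
      exact (Real.mul_self_sqrt (hf x)).symm
    change 0 ≤ (⟪v, φ f.toContinuousMap v⟫_ℂ).re
    rw [hg, map_mul, mul_apply_eq_comp, ← ContinuousLinearMap.coe_coe (φ g), ← hsymm g]
    exact inner_self_nonneg (𝕜 := ℂ)
  let Λ := PositiveLinearMap.mk₀ Λ₀ hpos
  have hme : MeasurableEmbedding (Subtype.val : spectrum ℝ S → ℝ) :=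
    MeasurableEmbedding.subtype_coe hX.measurableSet
  refine ⟨(RealRMK.rieszMeasure Λ).map Subtype.val, inferInstance, ?_, fun f hf => ?_⟩
  · rw [hme.map_apply]
    simp
  · rw [hme.integral_map, cfc_apply f S hS hf.continuousOn]
    let F : C(spectrum ℝ S, ℝ) := ⟨fun x => f x, by fun_prop⟩
    have := RealRMK.integral_rieszMeasure Λ (CompactlySupportedContinuousMap.continuousMapEquiv F)
    rw [← hreal]
    exact congrArg _ this

/-- The quarter-weights `i^p / 4` of the polarization identity. -/
def polWeight (p : Fin 4) : ℂ := Complex.I ^ (p : ℕ) / 4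

omit [CompleteSpace H] in
theorem polarization_sum (A : H →L[ℂ] H) (x y : H) :
    ∑ p : Fin 4, polWeight p *
      ⟪y + Complex.I ^ (p : ℕ) • x, A (y + Complex.I ^ (p : ℕ) • x)⟫_ℂ = ⟪x, A y⟫_ℂ := by
  simp only [polWeight, Fin.sum_univ_four, map_add, map_smul, inner_add_left, inner_add_right,
    inner_smul_left, inner_smul_right, map_pow, Complex.conj_I]
  norm_num [Fin.val_two, pow_succ, show ((3 : Fin 4) : ℕ) = 3 from rfl]
  ring_nf
  simp [Complex.I_sq]
  ring

theorem posSemidef_of_forall_nonneg {κ : Type} [Fintype κ] {A : Matrix κ κ ℂ}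
    (h : ∀ c : κ → ℂ, 0 ≤ star c ⬝ᵥ (A *ᵥ c)) : A.PosSemidef := by
  classical
  refine .of_dotProduct_mulVec_nonneg ?_ h
  rw [← Matrix.isSymmetric_toEuclideanLin_iff, LinearMap.isSymmetric_iff_inner_map_self_real]
  intro v
  have h1 := (Complex.le_def.1 (h (WithLp.ofLp v))).2
  rw [← inner_conj_symm, Complex.conj_conj, EuclideanSpace.inner_eq_star_dotProduct,
    dotProduct_comm]
  exact (Complex.conj_eq_iff_im.2 h1.symm).symm

/-- **Spectral theorem, matrix form.** For a bounded self-adjoint operator `S` and vectors `ξ k`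
there is a positive semidefinite matrix of compactly supported measures with
`∫ xⁿ dW_{kl} = ⟪ξ k, Sⁿ (ξ l)⟫`. -/
theorem exists_matrixMeasure_inner {κ : Type} [Fintype κ] {S : H →L[ℂ] H}
    (hS : IsSelfAdjoint S) (ξ : κ → H) :
    ∃ W : MatrixMeasure κ, (∀ s, MeasurableSet s → (Matrix.of fun k l => W k l s).PosSemidef) ∧
      (∀ k l, BddSupport (W k l)) ∧
      ∀ k l n, cint (W k l) (fun x => (x : ℂ) ^ n) = ⟪ξ k, (S ^ n) (ξ l)⟫_ℂ := by
  choose ρ hfin hsupp hint using exists_spectralMeasure hS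
  obtain ⟨M, hM⟩ := (ContinuousFunctionalCalculus.isCompact_spectrum (R := ℝ) S).isBounded
    |>.exists_norm_le
  have hM0 : ∀ v, ρ v {x | M < |x|} = 0 := fun v =>
    measure_mono_null (t := (spectrum ℝ S)ᶜ)
      (fun x (hx : M < |x|) hx' => absurd (hM x hx') (not_le.2 hx)) (hsupp v)
  let W : MatrixMeasure κ := fun k l =>
    comboMeasure polWeight fun p : Fin 4 => ρ (ξ l + Complex.I ^ (p : ℕ) • ξ k)
  have hW : ∀ k l s, MeasurableSet s →
      W k l s = ∑ p : Fin 4, polWeight p * ((ρ (ξ l + Complex.I ^ (p : ℕ) • ξ k)).real s : ℂ) :=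
    fun k l s hs => comboMeasure_apply _ _ hs
  refine ⟨W, fun s hs => ?_, fun k l => ⟨?_, M, ?_⟩, fun k l n => ?_⟩
  · refine posSemidef_of_forall_nonneg fun c => ?_
    -- The quadratic form of `W(s)` at `c` is the spectral measure of `∑ k, c k • ξ k`.
    suffices h : star c ⬝ᵥ ((Matrix.of fun k l => W k l s) *ᵥ c) =
        ((ρ (∑ k, c k • ξ k)).real s : ℂ) by
      rw [h]
      exact Complex.zero_le_real.2 measureReal_nonneg
    let τ : Option (κ × κ × Fin 4) → Measure ℝ := fun o => o.elim (ρ (∑ k, c k • ξ k))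
      fun q => ρ (ξ q.2.1 + Complex.I ^ (q.2.2 : ℕ) • ξ q.1)
    have : ∀ o, IsFiniteMeasure (τ o) := by
      rintro (_ | q) <;> exact hfin _
    have h := sum_measureReal_eq_zero
      (fun o : Option (κ × κ × Fin 4) =>
        o.elim (-1) fun q => star (c q.1) * c q.2.1 * polWeight q.2.2) τ
      (fun f => by
        simp only [Fintype.sum_option, Fintype.sum_prod_type, Option.elim, τ,
          hint _ _ f.continuous, mul_assoc, ← Finset.mul_sum]
        simp only [polarization_sum, map_sum, map_smul, sum_inner, inner_sum, inner_smul_left,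
          inner_smul_right]
        rw [neg_one_mul, neg_add_eq_zero]
        simp only [Finset.mul_sum]
        rw [Finset.sum_comm]
        refine Finset.sum_congr rfl fun k _ => Finset.sum_congr rfl fun l _ => ?_
        simp only [Complex.star_def]
        ring) s
    simp only [Fintype.sum_option, Fintype.sum_prod_type, Option.elim, τ, mul_assoc,
      ← Finset.mul_sum, ← hW _ _ s hs] at h
    rw [neg_one_mul, neg_add_eq_zero] at h
    rw [h]
    simp only [dotProduct, Matrix.mulVec, Matrix.of_apply, Finset.mul_sum, Pi.star_apply]
    refine Finset.sum_congr rfl fun k _ => Finset.sum_congr rfl fun l _ => ?_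
    ring
  · exact isFiniteMeasure_of_le _ (variation_comboMeasure_le _ _)
  · refine le_antisymm (((variation_comboMeasure_le _ _) _).trans ?_) zero_le
    simp [hM0]
  · have hi : ∀ v, Integrable (fun x : ℝ => (x : ℂ) ^ n) (ρ v) := by
      intro v
      obtain ⟨c, hc⟩ := exists_bound_of_abs_le (f := fun x : ℝ => (x : ℂ) ^ n) (by fun_prop) M
      refine Integrable.of_bound (by fun_prop) c ?_
      filter_upwards [measure_eq_zero_iff_ae_notMem.1 (hM0 v)] with x hx using hc x (not_lt.1 hx)
    have h1 : ∀ v, ∫ x : ℝ, (x : ℂ) ^ n ∂(ρ v) = ⟪v, (S ^ n) v⟫_ℂ := by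
      intro v
      rw [← cfc_pow_id (R := ℝ) S n hS, ← hint v (fun x => x ^ n) (continuous_pow n)]
      simpa using integral_ofReal (𝕜 := ℂ) (μ := ρ v) (f := fun x : ℝ => x ^ n)
    rw [cint_comboMeasure _ _ fun p => hi _]
    simp only [h1]
    exact polarization_sum (S ^ n) (ξ k) (ξ l)

end Spectral

/-! ### Symmetrizable operators -/

section Symmetrizable

open scoped InnerProductSpace

variable {H E : Type*} [NormedAddCommGroup H] [InnerProductSpace ℂ H] [AddCommGroup E] [Module ℂ E]
  {e : E →ₗ[ℂ] H} {T : E →ₗ[ℂ] E}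

theorem inner_pow_of_symmetric (hsym : ∀ f g, ⟪e (T f), e g⟫_ℂ = ⟪e f, e (T g)⟫_ℂ) (n : ℕ)
    (f g : E) : ⟪e ((T ^ n) f), e g⟫_ℂ = ⟪e f, e ((T ^ n) g)⟫_ℂ := by
  induction n generalizing f g with
  | zero => rfl
  | succ n ih =>
    rw [pow_succ, Module.End.mul_apply, ih, hsym, ← Module.End.mul_apply, ← pow_succ', pow_succ]

/-- **Krein's bound.** An operator that is symmetric for the form `⟪e ·, e ·⟫` and whose powers
grow at most like `Mⁿ` on each vector is bounded by `M` for the seminorm `‖e ·‖`. Indeed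
`n ↦ ‖e (Tⁿ f)‖` is log-convex, so that its growth rate bounds its first ratio. -/
theorem norm_apply_le_of_growth (hsym : ∀ f g, ⟪e (T f), e g⟫_ℂ = ⟪e f, e (T g)⟫_ℂ) {M : ℝ}
    (hM : 0 < M) (hgrow : ∀ f, ∃ C, ∀ n, ‖⟪e f, e ((T ^ n) f)⟫_ℂ‖ ≤ C * M ^ n) (f : E) :
    ‖e (T f)‖ ≤ M * ‖e f‖ := by
  obtain ⟨C, hC⟩ := hgrow f
  set a : ℕ → ℝ := fun n => ‖e ((T ^ n) f)‖ with ha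
  have ha0 : ∀ n, 0 ≤ a n := fun n => norm_nonneg _
  have hconv : ∀ n, a (n + 1) * a (n + 1) ≤ a n * a (n + 2) := by
    intro n
    have h1 : ⟪e ((T ^ (n + 1)) f), e ((T ^ (n + 1)) f)⟫_ℂ =
        ⟪e ((T ^ n) f), e ((T ^ (n + 2)) f)⟫_ℂ := by
      rw [show T ^ (n + 1) = T * T ^ n from pow_succ' T n, Module.End.mul_apply, hsym,
        show T ^ (n + 2) = T * (T * T ^ n) by rw [pow_succ', pow_succ']]
      rfl
    have h2 := norm_inner_le_norm (𝕜 := ℂ) (e ((T ^ n) f)) (e ((T ^ (n + 2)) f))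
    rw [← h1, inner_self_eq_norm_sq_to_K] at h2
    have h3 : ‖((‖e ((T ^ (n + 1)) f)‖ : ℂ)) ^ 2‖ = a (n + 1) * a (n + 1) := by
      rw [norm_pow, Complex.norm_real, norm_norm, sq]
    exact h3 ▸ h2
  have hsq : ∀ n, a n * a n ≤ C * M ^ (2 * n) := by
    intro n
    have h1 : ⟪e ((T ^ n) f), e ((T ^ n) f)⟫_ℂ = ⟪e f, e ((T ^ (2 * n)) f)⟫_ℂ := by
      rw [inner_pow_of_symmetric hsym, ← Module.End.mul_apply, ← pow_add, two_mul]
    have h2 := hC (2 * n)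
    rw [← h1, inner_self_eq_norm_sq_to_K] at h2
    have h3 : ‖((‖e ((T ^ n) f)‖ : ℂ)) ^ 2‖ = a n * a n := by
      rw [norm_pow, Complex.norm_real, norm_norm, sq]
    exact h3 ▸ h2
  by_contra hcon
  have hlt : M * a 0 < a 1 := by
    have := not_le.1 hcon
    simpa [ha] using this
  have h0 : 0 < a 0 := by
    refine lt_of_le_of_ne (ha0 0) fun h => ?_
    have := hconv 0
    rw [← h, zero_mul] at this
    rw [← h, mul_zero] at hlt
    nlinarith
  -- The ratio `a 1 / a 0` exceeds `M` and by log-convexity bounds all later ratios from below.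
  set q := a 1 / a 0 with hq
  have hqM : M < q := (lt_div_iff₀ h0).2 hlt
  have hq0 : 0 < q := hM.trans hqM
  have hstep : ∀ n, 0 < a n ∧ q * a n ≤ a (n + 1) := by
    intro n
    induction n with
    | zero => exact ⟨h0, le_of_eq (div_mul_cancel₀ _ h0.ne')⟩
    | succ n ih =>
      have h1 : 0 < a (n + 1) := (mul_pos hq0 ih.1).trans_le ih.2
      refine ⟨h1, ?_⟩
      have h2 : a n * (q * a (n + 1)) ≤ a n * a (n + 2) :=
        calc a n * (q * a (n + 1)) = (q * a n) * a (n + 1) := by ring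
          _ ≤ a (n + 1) * a (n + 1) := mul_le_mul_of_nonneg_right ih.2 h1.le
          _ ≤ _ := hconv n
      exact le_of_mul_le_mul_left h2 ih.1
  have hge : ∀ n, q ^ n * a 0 ≤ a n := by
    intro n
    induction n with
    | zero => simp
    | succ n ih =>
      calc q ^ (n + 1) * a 0 = q * (q ^ n * a 0) := by ring
        _ ≤ q * a n := mul_le_mul_of_nonneg_left ih hq0.le
        _ ≤ _ := (hstep n).2
  have hbd : ∀ n, ((q / M) ^ 2) ^ n ≤ C / (a 0 * a 0) := by
    intro n
    rw [le_div_iff₀ (mul_pos h0 h0), ← pow_mul, div_pow, div_mul_eq_mul_div,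
      div_le_iff₀ (by positivity)]
    calc q ^ (2 * n) * (a 0 * a 0) = (q ^ n * a 0) * (q ^ n * a 0) := by ring
      _ ≤ a n * a n := mul_le_mul (hge n) (hge n) (by positivity) (ha0 n)
      _ ≤ _ := hsq n
  have h1 : 1 < (q / M) ^ 2 := one_lt_pow₀ ((one_lt_div hM).2 hqM) two_ne_zero
  obtain ⟨n, hn⟩ := ((tendsto_pow_atTop_atTop_of_one_lt h1).eventually_gt_atTop
    (C / (a 0 * a 0))).exists
  exact absurd (hbd n) (not_le.2 hn)

/-- The moments of a symmetric operator of geometric growth form a moment sequence of a positive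
semidefinite matrix of compactly supported measures. -/
theorem exists_matrixMeasure_of_symmetric [CompleteSpace H] (he : DenseRange e)
    (hsym : ∀ f g, ⟪e (T f), e g⟫_ℂ = ⟪e f, e (T g)⟫_ℂ) {M : ℝ} (hM : 0 < M)
    (hgrow : ∀ f, ∃ C, ∀ n, ‖⟪e f, e ((T ^ n) f)⟫_ℂ‖ ≤ C * M ^ n)
    {κ : Type} [Fintype κ] (v : κ → E) :
    ∃ W : MatrixMeasure κ, (∀ s, MeasurableSet s → (Matrix.of fun k l => W k l s).PosSemidef) ∧
      (∀ k l, BddSupport (W k l)) ∧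
      ∀ k l n, cint (W k l) (fun x => (x : ℂ) ^ n) = ⟪e (v k), e ((T ^ n) (v l))⟫_ℂ := by
  let S : H →L[ℂ] H := (e ∘ₗ T).extendOfNorm e
  have hSe : ∀ f, S (e f) = e (T f) := fun f =>
    LinearMap.extendOfNorm_eq he ⟨M, norm_apply_le_of_growth hsym hM hgrow⟩ f
  have hSn : ∀ n f, (S ^ n) (e f) = e ((T ^ n) f) := by
    intro n
    induction n with
    | zero => exact fun _ => rfl
    | succ n ih =>
      intro f
      rw [pow_succ, pow_succ, mul_apply_eq_comp, Module.End.mul_apply, hSe, ih]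
  have hS : IsSelfAdjoint S := by
    rw [ContinuousLinearMap.isSelfAdjoint_iff_isSymmetric]
    intro x y
    change ⟪S x, y⟫_ℂ = ⟪x, S y⟫_ℂ
    refine he.induction_on₂ (p := fun x y => ⟪S x, y⟫_ℂ = ⟪x, S y⟫_ℂ) ?_ ?_ x y
    · exact isClosed_eq (by fun_prop) (by fun_prop)
    · intro f g
      rw [hSe, hSe, hsym]
  obtain ⟨W, h1, h2, h3⟩ := exists_matrixMeasure_inner hS fun k => e (v k)
  exact ⟨W, h1, h2, fun k l n => by rw [h3, hSn]⟩

end Symmetrizable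

/-! ### Banded block matrices -/

section Banded

open scoped InnerProductSpace

variable {V ι : Type} [Fintype ι] [DecidableEq ι] [DecidableEq V]

/-- `BandedBy K S`: column `i` of the block matrix `K` is supported in the finite set `S i`. -/
def BandedBy (K : V → V → Matrix ι ι ℂ) (S : V → Finset V) : Prop :=
  ∀ i j, j ∉ S i → K j i = 0

variable {K : V → V → Matrix ι ι ℂ} {S : V → Finset V}

omit [DecidableEq ι] in
theorem lp_sum_single_apply {p : ENNReal} (s : Finset V) (g : V → EuclideanSpace ℂ ι) (j : V) :
    (∑ k ∈ s, lp.single (E := fun _ : V => EuclideanSpace ℂ ι) p k (g k) :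
      lp (fun _ : V => EuclideanSpace ℂ ι) p) j = if j ∈ s then g j else 0 := by
  rw [lp.coeFn_sum, Finset.sum_apply]
  simp only [lp.coeFn_single]
  exact Finset.sum_pi_single j g s

theorem blockOp_single (hK : ColBounded K) (hS : BandedBy K S) (i : V) (v : EuclideanSpace ℂ ι) :
    blockOp K hK (lp.single 1 i v) =
      ∑ j ∈ S i, lp.single 1 j (Matrix.toEuclideanCLM (𝕜 := ℂ) (K j i) v) := by
  ext1
  funext j
  rw [lp_sum_single_apply, blockOp_apply, tsum_eq_single i, lp.single_apply_self]
  · split_ifs with h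
    · rfl
    · rw [hS i j h, map_zero]; rfl
  · intro k hk
    have h := lp.single_apply_ne (E := fun _ : V => EuclideanSpace ℂ ι) 1 i v hk
    exact (congrArg _ h).trans (map_zero _)

/-- The action of a banded block matrix on finitely supported functions. -/
def finOp (K : V → V → Matrix ι ι ℂ) (S : V → Finset V) :
    (V →₀ EuclideanSpace ℂ ι) →ₗ[ℂ] (V →₀ EuclideanSpace ℂ ι) :=
  Finsupp.lsum ℂ fun i => ∑ j ∈ S i,
    (Finsupp.lsingle j).comp (Matrix.toEuclideanCLM (𝕜 := ℂ) (K j i)).toLinearMap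

omit [DecidableEq V] in
theorem finOp_single (i : V) (v : EuclideanSpace ℂ ι) :
    finOp K S (Finsupp.single i v) =
      ∑ j ∈ S i, Finsupp.single j (Matrix.toEuclideanCLM (𝕜 := ℂ) (K j i) v) := by
  rw [finOp, Finsupp.lsum_single, LinearMap.sum_apply]
  rfl

/-- The map `f ↦ (R_n f_n)_n` from finitely supported functions to `ℓᵖ(V; ℂ^ι)`. -/
def weightEmb (p : ENNReal) (R : V → Matrix ι ι ℂ) :
    (V →₀ EuclideanSpace ℂ ι) →ₗ[ℂ] lp (fun _ : V => EuclideanSpace ℂ ι) p :=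
  Finsupp.lsum ℂ fun i => (lp.lsingle p i).comp (Matrix.toEuclideanCLM (𝕜 := ℂ) (R i)).toLinearMap

theorem weightEmb_single (p : ENNReal) (R : V → Matrix ι ι ℂ) (i : V) (v : EuclideanSpace ℂ ι) :
    weightEmb p R (Finsupp.single i v) =
      lp.single p i (Matrix.toEuclideanCLM (𝕜 := ℂ) (R i) v) := by
  rw [weightEmb, Finsupp.lsum_single]
  rfl

theorem weightEmb_apply (p : ENNReal) (R : V → Matrix ι ι ℂ) (f : V →₀ EuclideanSpace ℂ ι)
    (j : V) : weightEmb p R f j = Matrix.toEuclideanCLM (𝕜 := ℂ) (R j) (f j) := by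
  induction f using Finsupp.induction_linear with
  | zero => simp
  | add f g hf hg => rw [map_add, lp.coeFn_add, Pi.add_apply, hf, hg, Finsupp.add_apply, map_add]
  | single i v =>
    rw [weightEmb_single, lp.single_apply]
    by_cases h : j = i
    · subst h; simp
    · rw [Pi.single_eq_of_ne h, Finsupp.single_eq_of_ne h, map_zero]

theorem denseRange_weightEmb {R : V → Matrix ι ι ℂ} (hR : ∀ n, IsUnit (R n).det) :
    DenseRange (weightEmb 2 R) := by
  intro f
  refine mem_closure_of_tendsto (lp.hasSum_single ENNReal.ofNat_ne_top f)
    (Eventually.of_forall fun s => ?_)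
  refine ⟨∑ i ∈ s, Finsupp.single i (Matrix.toEuclideanCLM (𝕜 := ℂ) (R i)⁻¹ (f i)), ?_⟩
  rw [map_sum]
  refine Finset.sum_congr rfl fun i _ => ?_
  rw [weightEmb_single, ← mul_apply_eq_comp, ← map_mul, Matrix.mul_nonsing_inv _ (hR i), map_one]
  rfl

theorem weightEmb_one_finOp (hK : ColBounded K) (hS : BandedBy K S)
    (f : V →₀ EuclideanSpace ℂ ι) :
    weightEmb 1 1 (finOp K S f) = blockOp K hK (weightEmb 1 1 f) := by
  induction f using Finsupp.induction_linear with
  | zero => simp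
  | add f g hf hg => rw [map_add, map_add, hf, hg, map_add, map_add]
  | single i v =>
    rw [finOp_single, map_sum, weightEmb_single, blockOp_single hK hS]
    refine Finset.sum_congr rfl fun j _ => ?_
    rw [weightEmb_single]
    simp

theorem inner_weightEmb_single (R : V → Matrix ι ι ℂ) (i : V) (v : EuclideanSpace ℂ ι)
    (g : V →₀ EuclideanSpace ℂ ι) :
    ⟪weightEmb 2 R (Finsupp.single i v), weightEmb 2 R g⟫_ℂ =
      ⟪v, Matrix.toEuclideanCLM (𝕜 := ℂ) ((R i)ᴴ * R i) (g i)⟫_ℂ := by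
  rw [weightEmb_single, lp.inner_single_left, weightEmb_apply, map_mul, mul_apply_eq_comp,
    ← Matrix.star_eq_conjTranspose, map_star, ContinuousLinearMap.star_eq_adjoint,
    ContinuousLinearMap.adjoint_inner_right]

theorem norm_clm_pow_le {B : Type*} [SeminormedAddCommGroup B] [NormedSpace ℂ B] (T : B →L[ℂ] B)
    (n : ℕ) : ‖T ^ n‖ ≤ ‖T‖ ^ n := by
  rcases n.eq_zero_or_pos with rfl | hn
  · simp only [pow_zero]
    exact ContinuousLinearMap.norm_id_le
  · exact norm_pow_le' _ hn

/-- The powers of a banded operator, bounded on `ℓ¹`, grow geometrically for the weighted form. -/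
theorem inner_finOp_growth (hK : ColBounded K) (hS : BandedBy K S) (R : V → Matrix ι ι ℂ)
    (f : V →₀ EuclideanSpace ℂ ι) :
    ∃ C, ∀ n, ‖⟪weightEmb 2 R f, weightEmb 2 R ((finOp K S ^ n) f)⟫_ℂ‖ ≤
      C * (‖blockOp K hK‖ + 1) ^ n := by
  have h1 : ∀ f : V →₀ EuclideanSpace ℂ ι, ∃ C, 0 ≤ C ∧ ∀ g,
      ‖⟪weightEmb 2 R f, weightEmb 2 R g⟫_ℂ‖ ≤ C * ‖weightEmb 1 1 g‖ := by
    intro f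
    induction f using Finsupp.induction_linear with
    | zero => exact ⟨0, le_rfl, fun g => by simp⟩
    | add f g hf hg =>
      obtain ⟨C, hC0, hC⟩ := hf
      obtain ⟨D, hD0, hD⟩ := hg
      refine ⟨C + D, add_nonneg hC0 hD0, fun g => ?_⟩
      rw [map_add, inner_add_left, add_mul]
      exact (norm_add_le _ _).trans (add_le_add (hC g) (hD g))
    | single i v =>
      refine ⟨‖v‖ * ‖Matrix.toEuclideanCLM (𝕜 := ℂ) ((R i)ᴴ * R i)‖, by positivity, fun g => ?_⟩
      rw [inner_weightEmb_single, mul_assoc]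
      refine (norm_inner_le_norm _ _).trans (mul_le_mul_of_nonneg_left ?_ (norm_nonneg _))
      refine (ContinuousLinearMap.le_opNorm _ _).trans
        (mul_le_mul_of_nonneg_left ?_ (norm_nonneg _))
      have h2 := lp.norm_apply_le_norm one_ne_zero (weightEmb 1 1 g) i
      rw [weightEmb_apply] at h2
      simpa using h2
  obtain ⟨C, hC0, hC⟩ := h1 f
  have h2 : ∀ n, weightEmb 1 1 ((finOp K S ^ n) f) = (blockOp K hK ^ n) (weightEmb 1 1 f) := by
    intro n
    induction n with
    | zero => rfl
    | succ n ih =>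
      rw [pow_succ', pow_succ', Module.End.mul_apply, mul_apply_eq_comp,
        weightEmb_one_finOp hK hS, ih]
  refine ⟨C * ‖weightEmb 1 1 f‖, fun n => (hC _).trans ?_⟩
  rw [h2, mul_assoc]
  refine mul_le_mul_of_nonneg_left ?_ hC0
  rw [mul_comm]
  refine (ContinuousLinearMap.le_opNorm _ _).trans
    (mul_le_mul_of_nonneg_right ?_ (norm_nonneg _))
  exact (norm_clm_pow_le _ n).trans
    (pow_le_pow_left₀ (norm_nonneg _) (le_add_of_nonneg_right zero_le_one) n)

theorem finOp_apply (hS : BandedBy K S) (i : V) (v : EuclideanSpace ℂ ι) (j : V) :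
    finOp K S (Finsupp.single i v) j = Matrix.toEuclideanCLM (𝕜 := ℂ) (K j i) v := by
  rw [finOp_single, Finsupp.finsetSum_apply]
  simp only [Finsupp.single_apply]
  rw [Finset.sum_ite_eq']
  split_ifs with h
  · rfl
  · rw [hS i j h, map_zero]; rfl

theorem finOp_symmetric (hS : BandedBy K S) {R : V → Matrix ι ι ℂ}
    (hKR : ∀ j i, (R j)ᴴ * R j * K j i = (K i j)ᴴ * ((R i)ᴴ * R i))
    (f g : V →₀ EuclideanSpace ℂ ι) :
    ⟪weightEmb 2 R (finOp K S f), weightEmb 2 R g⟫_ℂ =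
      ⟪weightEmb 2 R f, weightEmb 2 R (finOp K S g)⟫_ℂ := by
  induction f using Finsupp.induction_linear with
  | zero => simp
  | add f g hf hg => simp only [map_add, inner_add_left, hf, hg]
  | single i v =>
    induction g using Finsupp.induction_linear with
    | zero => simp
    | add f g hf hg => simp only [map_add, inner_add_right, hf, hg]
    | single j w =>
      have hadj : Matrix.toEuclideanCLM (𝕜 := ℂ) ((R j)ᴴ * R j * K j i) =
          ContinuousLinearMap.adjoint
            (Matrix.toEuclideanCLM (𝕜 := ℂ) ((R i)ᴴ * R i * K i j)) := by
        rw [← ContinuousLinearMap.star_eq_adjoint, ← map_star, Matrix.star_eq_conjTranspose, hKR,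
          Matrix.conjTranspose_mul, Matrix.conjTranspose_mul, Matrix.conjTranspose_conjTranspose]
      rw [inner_weightEmb_single, finOp_apply hS, ← inner_conj_symm, inner_weightEmb_single,
        inner_conj_symm, finOp_apply hS, ← mul_apply_eq_comp, ← map_mul,
        ← mul_apply_eq_comp, ← map_mul,
        hadj, ContinuousLinearMap.adjoint_inner_left]

end Banded

/-! ### Blocks of powers and of exponentials -/

section Blocks

variable {V ι : Type} [Fintype ι] [DecidableEq ι] [DecidableEq V]
  {K : V → V → Matrix ι ι ℂ} {S : V → Finset V}

theorem apply_single_eq_sum (T : BlockSpace V ι →L[ℂ] BlockSpace V ι) (j k : V)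
    (v : EuclideanSpace ℂ ι) (a : ι) :
    (T (lp.single 1 k v) j) a = ∑ c, blockOf T j k a c * v c := by
  have hv : v = ∑ c, v c • EuclideanSpace.single c (1 : ℂ) := by
    ext a
    simp [Pi.single_apply]
  have h1 : (lp.single 1 k v : BlockSpace V ι) =
      ∑ c, v c • lp.single 1 k (EuclideanSpace.single c (1 : ℂ)) := by
    conv_lhs => rw [hv]
    have := map_sum (lp.lsingle (𝕜 := ℂ) (E := fun _ : V => EuclideanSpace ℂ ι) 1 k)
      (fun c => v c • EuclideanSpace.single c (1 : ℂ)) Finset.univ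
    simp only [map_smul] at this
    exact this
  rw [h1, map_sum, lp.coeFn_sum, Finset.sum_apply, WithLp.ofLp_sum, Finset.sum_apply]
  refine Finset.sum_congr rfl fun c _ => ?_
  rw [map_smul, mul_comm]
  rfl

theorem blockOf_one (j i : V) :
    blockOf (1 : BlockSpace V ι →L[ℂ] BlockSpace V ι) j i = if j = i then 1 else 0 := by
  ext a b
  change ((lp.single 1 i (EuclideanSpace.single b 1) : BlockSpace V ι) j) a = _
  rw [lp.single_apply]
  by_cases h : j = i
  · subst h
    simp [Matrix.one_apply]
  · rw [Pi.single_eq_of_ne h, if_neg h]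
    rfl

theorem blockOf_pow_succ (hK : ColBounded K) (hS : BandedBy K S) (n : ℕ) (j i : V) :
    blockOf (blockOp K hK ^ (n + 1)) j i =
      ∑ k ∈ S i, blockOf (blockOp K hK ^ n) j k * K k i := by
  ext a b
  have h1 : blockOf (blockOp K hK ^ (n + 1)) j i a b = ((blockOp K hK ^ n)
      (blockOp K hK (lp.single 1 i (EuclideanSpace.single b 1))) j) a := by
    rw [pow_succ]
    rfl
  rw [h1, blockOp_single hK hS, map_sum, lp.coeFn_sum, Finset.sum_apply, WithLp.ofLp_sum,
    Finset.sum_apply, Matrix.sum_apply]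
  refine Finset.sum_congr rfl fun k _ => ?_
  rw [apply_single_eq_sum, Matrix.mul_apply]
  refine Finset.sum_congr rfl fun c _ => ?_
  congr 1
  change (K k i *ᵥ (Pi.single b 1 : ι → ℂ)) c = _
  simp

/-- The functional `T ↦ (T_{ji})_{ab}`, continuous for the operator norm. -/
def blockEntry (j i : V) (a b : ι) : (BlockSpace V ι →L[ℂ] BlockSpace V ι) →L[ℂ] ℂ :=
  (EuclideanSpace.proj a : EuclideanSpace ℂ ι →L[ℂ] ℂ) ∘L
    (lp.evalCLM ℂ (fun _ : V => EuclideanSpace ℂ ι) 1 j) ∘L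
    (ContinuousLinearMap.apply ℂ (BlockSpace V ι) (lp.single 1 i (EuclideanSpace.single b 1)))

theorem blockEntry_apply (j i : V) (a b : ι) (T : BlockSpace V ι →L[ℂ] BlockSpace V ι) :
    blockEntry j i a b T = blockOf T j i a b := rfl

theorem hasSum_blockOf_exp (L : BlockSpace V ι →L[ℂ] BlockSpace V ι) (t : ℝ) (j i : V) (a b : ι) :
    HasSum (fun n : ℕ => ((n.factorial : ℂ)⁻¹ * (t : ℂ) ^ n) * blockOf (L ^ n) j i a b)
      (blockOf (NormedSpace.exp ((t : ℂ) • L)) j i a b) := by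
  have h := (NormedSpace.exp_series_hasSum_exp' (𝕂 := ℂ) ((t : ℂ) • L)).mapL
    (blockEntry j i a b)
  rw [blockEntry_apply] at h
  convert h using 2 with n
  rw [map_smul, smul_pow, map_smul, smul_eq_mul, smul_eq_mul, mul_assoc, blockEntry_apply]

theorem norm_blockOf_le (T : BlockSpace V ι →L[ℂ] BlockSpace V ι) (j i : V) (a b : ι) :
    ‖blockOf T j i a b‖ ≤ ‖T‖ := by
  refine (PiLp.norm_apply_le (T (lp.single 1 i (EuclideanSpace.single b 1)) j) a).trans ?_
  refine (lp.norm_apply_le_norm one_ne_zero _ j).trans ?_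
  refine (T.le_opNorm _).trans_eq ?_
  rw [lp.norm_single zero_lt_one]
  simp

end Blocks

/-! ### Polynomial functions and matrix-valued pairings -/

/-- The polynomial functions `ℝ → ℂ` with complex coefficients. -/
def polyFun : Subalgebra ℂ (ℝ → ℂ) :=
  (Polynomial.aeval (fun x : ℝ => (x : ℂ)) : Polynomial ℂ →ₐ[ℂ] (ℝ → ℂ)).range

theorem mem_polyFun {f : ℝ → ℂ} :
    f ∈ polyFun ↔ ∃ p : Polynomial ℂ, ∀ x : ℝ, f x = p.eval (x : ℂ) := by
  have h : ∀ (p : Polynomial ℂ) (x : ℝ),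
      Polynomial.aeval (fun x : ℝ => (x : ℂ)) p x = p.eval (x : ℂ) := by
    intro p x
    have := Polynomial.aeval_algHom_apply (Pi.evalAlgHom ℂ (fun _ : ℝ => ℂ) x)
      (fun x : ℝ => (x : ℂ)) p
    rw [← Polynomial.coe_aeval_eq_eval]
    exact this.symm
  constructor
  · rintro ⟨p, rfl⟩
    exact ⟨p, h p⟩
  · rintro ⟨p, hp⟩
    exact ⟨p, funext fun x => (h p x).trans (hp x).symm⟩

theorem coe_mem_polyFun : (fun x : ℝ => (x : ℂ)) ∈ polyFun :=
  mem_polyFun.2 ⟨Polynomial.X, fun x => by simp⟩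

theorem const_mem_polyFun (c : ℂ) : (fun _ : ℝ => c) ∈ polyFun :=
  mem_polyFun.2 ⟨Polynomial.C c, fun x => by simp⟩

theorem star_mem_polyFun {f : ℝ → ℂ} (hf : f ∈ polyFun) : (fun x => star (f x)) ∈ polyFun := by
  obtain ⟨p, hp⟩ := mem_polyFun.1 hf
  refine mem_polyFun.2 ⟨p.map (starRingEnd ℂ), fun x => ?_⟩
  change starRingEnd ℂ (f x) = _
  rw [hp, ← Complex.conj_ofReal x, Polynomial.eval_map_apply, Complex.conj_ofReal]

theorem continuous_of_mem_polyFun {f : ℝ → ℂ} (hf : f ∈ polyFun) : Continuous f := by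
  obtain ⟨p, hp⟩ := mem_polyFun.1 hf
  rw [funext hp]
  fun_prop

theorem integrable_of_mem_polyFun {ν : ComplexMeasure ℝ}
    (hν : ∀ n : ℕ, ν.Integrable fun x : ℝ => (x : ℂ) ^ n) {f : ℝ → ℂ} (hf : f ∈ polyFun) :
    ν.Integrable f := by
  obtain ⟨p, hp⟩ := mem_polyFun.1 hf
  rw [funext hp]
  simp only [Polynomial.eval_eq_sum, Polynomial.sum]
  exact integrable_finsetSum _ fun n _ => (hν n).const_mul _

section Pairing

variable {κ ι : Type} [Fintype κ] [Fintype ι]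

/-- The matrix `∫ φ(x) P(x)^* dU(x) Q(x)` for rectangular `P` and `Q`. -/
def pairing (U : MatrixMeasure κ) (φ : ℝ → ℂ) (P Q : ℝ → Matrix κ ι ℂ) : Matrix ι ι ℂ :=
  Matrix.of fun a b => ∑ k, ∑ l, cint (U k l) fun x => φ x * star (P x k a) * Q x l b

/-- All entries of `φ(x) P(x)^* dU(x) Q(x)` are integrable. -/
def PairingIntegrable (U : MatrixMeasure κ) (φ : ℝ → ℂ) (P Q : ℝ → Matrix κ ι ℂ) : Prop :=
  ∀ a b k l, (U k l).Integrable fun x => φ x * star (P x k a) * Q x l b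

variable {U : MatrixMeasure κ} {φ : ℝ → ℂ}

theorem pairing_sum_mul_right {V : Type} {P : ℝ → Matrix κ ι ℂ} {s : Finset V}
    {Q : V → ℝ → Matrix κ ι ℂ} (C : V → Matrix ι ι ℂ)
    (h : ∀ k ∈ s, PairingIntegrable U φ P (Q k)) :
    pairing U φ P (fun x => ∑ k ∈ s, Q k x * C k) = ∑ k ∈ s, pairing U φ P (Q k) * C k := by
  ext a b
  simp only [pairing, Matrix.sum_apply, Matrix.of_apply, Matrix.mul_apply]
  have h1 : ∀ p q, cint (U p q) (fun x => φ x * star (P x p a) * ∑ k ∈ s, ∑ c, Q k x q c * C k c b)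
      = ∑ k ∈ s, ∑ c, cint (U p q) (fun x => φ x * star (P x p a) * Q k x q c) * C k c b := by
    intro p q
    simp only [Finset.mul_sum, ← mul_assoc]
    have hi : ∀ k ∈ s, ∀ c, (U p q).Integrable fun x =>
        φ x * star (P x p a) * Q k x q c * C k c b := fun k hk c => (h k hk a c p q).mul_const _
    unfold cint
    rw [VectorMeasure.integral_finsetSum _ fun k hk => integrable_finsetSum _ fun c _ => hi k hk c]
    refine Finset.sum_congr rfl fun k hk => ?_
    rw [VectorMeasure.integral_finsetSum _ fun c _ => hi k hk c]
    refine Finset.sum_congr rfl fun c _ => ?_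
    rw [mul_comm _ (C k c b), ← cint_const_mul]
    simp only [mul_comm (C k c b)]
  simp only [h1, Finset.sum_mul]
  rw [Finset.sum_congr rfl fun p _ => Finset.sum_comm, Finset.sum_comm]
  refine Finset.sum_congr rfl fun k _ => ?_
  rw [Finset.sum_congr rfl fun p _ => Finset.sum_comm, Finset.sum_comm]

theorem pairing_sum_mul_left {V : Type} {P : ℝ → Matrix κ ι ℂ} {s : Finset V}
    {Q : V → ℝ → Matrix κ ι ℂ} (C : V → Matrix ι ι ℂ)
    (h : ∀ k ∈ s, PairingIntegrable U φ (Q k) P) :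
    pairing U φ (fun x => ∑ k ∈ s, Q k x * C k) P =
      ∑ k ∈ s, (C k)ᴴ * pairing U φ (Q k) P := by
  ext a b
  simp only [pairing, Matrix.sum_apply, Matrix.of_apply, Matrix.mul_apply,
    Matrix.conjTranspose_apply]
  have h1 : ∀ p q, cint (U p q) (fun x => φ x * star (∑ k ∈ s, ∑ c, Q k x p c * C k c a) * P x q b)
      = ∑ k ∈ s, ∑ c, star (C k c a) *
        cint (U p q) (fun x => φ x * star (Q k x p c) * P x q b) := by
    intro p q
    have hi : ∀ k ∈ s, ∀ c, (U p q).Integrable fun x =>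
        star (C k c a) * (φ x * star (Q k x p c) * P x q b) :=
      fun k hk c => (h k hk c b p q).const_mul _
    have e1 : (fun x => φ x * star (∑ k ∈ s, ∑ c, Q k x p c * C k c a) * P x q b) =
        fun x => ∑ k ∈ s, ∑ c, star (C k c a) * (φ x * star (Q k x p c) * P x q b) := by
      funext x
      simp only [star_sum, Finset.mul_sum, Finset.sum_mul, star_mul']
      exact Finset.sum_congr rfl fun k _ => Finset.sum_congr rfl fun c _ => by ring
    rw [e1]
    unfold cint
    rw [VectorMeasure.integral_finsetSum _ fun k hk => integrable_finsetSum _ fun c _ => hi k hk c]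
    refine Finset.sum_congr rfl fun k hk => ?_
    rw [VectorMeasure.integral_finsetSum _ fun c _ => hi k hk c]
    exact Finset.sum_congr rfl fun c _ => cint_const_mul _ _ _
  simp only [h1, Finset.mul_sum]
  rw [Finset.sum_congr rfl fun p _ => Finset.sum_comm, Finset.sum_comm]
  refine Finset.sum_congr rfl fun k _ => ?_
  rw [Finset.sum_congr rfl fun p _ => Finset.sum_comm, Finset.sum_comm]

omit [Fintype ι] in
theorem pairing_neg_smul_right (n : ℕ) (P Q : ℝ → Matrix κ ι ℂ) :
    pairing U (fun x => (x : ℂ) ^ n) P (fun x => -((x : ℂ) • Q x)) =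
      -pairing U (fun x => (x : ℂ) ^ (n + 1)) P Q := by
  ext a b
  simp only [pairing, Matrix.of_apply, Matrix.neg_apply, Matrix.smul_apply, smul_eq_mul]
  rw [← neg_one_mul, Finset.mul_sum]
  refine Finset.sum_congr rfl fun k _ => ?_
  rw [Finset.mul_sum]
  refine Finset.sum_congr rfl fun l _ => ?_
  rw [← cint_const_mul]
  congr 1
  funext x
  ring

omit [Fintype ι] in
theorem pairing_neg_smul_left (n : ℕ) (P Q : ℝ → Matrix κ ι ℂ) :
    pairing U (fun x => (x : ℂ) ^ n) (fun x => -((x : ℂ) • P x)) Q =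
      -pairing U (fun x => (x : ℂ) ^ (n + 1)) P Q := by
  ext a b
  simp only [pairing, Matrix.of_apply, Matrix.neg_apply, Matrix.smul_apply, smul_eq_mul]
  rw [← neg_one_mul, Finset.mul_sum]
  refine Finset.sum_congr rfl fun k _ => ?_
  rw [Finset.mul_sum]
  refine Finset.sum_congr rfl fun l _ => ?_
  rw [← cint_const_mul]
  congr 1
  funext x
  rw [star_neg, star_mul', Complex.star_def, Complex.conj_ofReal]
  ring

theorem sandwich_eq_pairing {U : MatrixMeasure ι} (P Q : ℝ → Matrix ι ι ℂ) :
    sandwich U φ P Q = pairing U φ P Q := rfl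

end Pairing

/-! ### The Karlin-McGregor representation of a banded semigroup -/

section Representation

variable {V κ ι : Type} [Fintype κ] [Fintype ι] {K : V → V → Matrix ι ι ℂ} {S : V → Finset V}
  {U : MatrixMeasure κ} {P : V → ℝ → Matrix κ ι ℂ}

/-- `IsEigenRow K S P`: the entries of `P` are polynomials, and the row `(P_i(x))_i` is a left
eigenvector of the block matrix `K` for the eigenvalue `-x`. -/
structure IsEigenRow (K : V → V → Matrix ι ι ℂ) (S : V → Finset V)
    (P : V → ℝ → Matrix κ ι ℂ) : Prop where
  mem_polyFun : ∀ i k a, (fun x => P i x k a) ∈ polyFun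
  sum_mul : ∀ i x, ∑ k ∈ S i, P k x * K k i = -((x : ℂ) • P i x)

omit [Fintype κ] in
theorem IsEigenRow.pairingIntegrable (hP : IsEigenRow K S P)
    (hU : ∀ k l, ∀ n : ℕ, (U k l).Integrable fun x : ℝ => (x : ℂ) ^ n) (n : ℕ) (j i : V) :
    PairingIntegrable U (fun x => (x : ℂ) ^ n) (P j) (P i) := fun a b k l =>
  integrable_of_mem_polyFun (hU k l) <| polyFun.mul_mem
    (polyFun.mul_mem (polyFun.pow_mem coe_mem_polyFun n) (star_mem_polyFun (hP.mem_polyFun j k a)))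
    (hP.mem_polyFun i l b)

theorem IsEigenRow.pairing_succ_right (hP : IsEigenRow K S P)
    (hU : ∀ k l, ∀ n : ℕ, (U k l).Integrable fun x : ℝ => (x : ℂ) ^ n) (n : ℕ) (j i : V) :
    ∑ k ∈ S i, pairing U (fun x => (x : ℂ) ^ n) (P j) (P k) * K k i =
      -pairing U (fun x => (x : ℂ) ^ (n + 1)) (P j) (P i) := by
  rw [← pairing_sum_mul_right _ fun k _ => hP.pairingIntegrable hU n j k,
    ← pairing_neg_smul_right]
  simp only [hP.sum_mul]

theorem IsEigenRow.pairing_succ_left (hP : IsEigenRow K S P)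
    (hU : ∀ k l, ∀ n : ℕ, (U k l).Integrable fun x : ℝ => (x : ℂ) ^ n) (n : ℕ) (j i : V) :
    ∑ k ∈ S j, (K k j)ᴴ * pairing U (fun x => (x : ℂ) ^ n) (P k) (P i) =
      -pairing U (fun x => (x : ℂ) ^ (n + 1)) (P j) (P i) := by
  rw [← pairing_sum_mul_left _ fun k _ => hP.pairingIntegrable hU n k i,
    ← pairing_neg_smul_left]
  simp only [hP.sum_mul]

variable [DecidableEq V] [DecidableEq ι] {G : V → Matrix ι ι ℂ}

/-- Orthogonality and the eigenvector relation determine all moments: the `n`-th one represents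
the block of the `n`-th power of `-K`. -/
theorem IsEigenRow.pairing_pow (hP : IsEigenRow K S P) (hK : ColBounded K) (hS : BandedBy K S)
    (hU : ∀ k l, ∀ n : ℕ, (U k l).Integrable fun x : ℝ => (x : ℂ) ^ n)
    (hG : ∀ j i, pairing U (fun _ => 1) (P j) (P i) = if j = i then G j else 0)
    (n : ℕ) (j i : V) :
    pairing U (fun x => (x : ℂ) ^ n) (P j) (P i) =
      (-1 : ℂ) ^ n • (G j * blockOf (blockOp K hK ^ n) j i) := by
  induction n generalizing i with
  | zero =>
    simp only [pow_zero, one_smul]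
    rw [hG, blockOf_one]
    split_ifs <;> simp
  | succ n ih =>
    have h := hP.pairing_succ_right hU n j i
    rw [eq_neg_iff_add_eq_zero, ← neg_eq_iff_add_eq_zero] at h
    rw [← h, blockOf_pow_succ hK hS, Finset.mul_sum, Finset.smul_sum, ← Finset.sum_neg_distrib]
    refine Finset.sum_congr rfl fun k _ => ?_
    rw [ih, pow_succ, Matrix.smul_mul, Matrix.mul_assoc, mul_neg_one, neg_smul]

omit [Fintype κ] [DecidableEq V] [DecidableEq ι] in
theorem IsEigenRow.pairingIntegrable_exp (hP : IsEigenRow K S P)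
    (hU : ∀ k l, BddSupport (U k l)) (t : ℝ) (j i : V) :
    PairingIntegrable U (fun x => Complex.exp (-(x * t))) (P j) (P i) := fun a b k l => by
  have h1 := continuous_of_mem_polyFun (star_mem_polyFun (hP.mem_polyFun j k a))
  have h2 := continuous_of_mem_polyFun (hP.mem_polyFun i l b)
  exact (hU k l).integrable (by fun_prop)

/-- The exponential series can be integrated termwise against a compactly supported measure. -/
theorem BddSupport.hasSum_cint_exp {ν : ComplexMeasure ℝ} (hν : BddSupport ν) {g : ℝ → ℂ}
    (hg : Continuous g) (t : ℝ) :
    HasSum (fun n : ℕ => ((n.factorial : ℂ)⁻¹ * (-t : ℂ) ^ n) *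
      cint ν (fun x => (x : ℂ) ^ n * g x)) (cint ν fun x => Complex.exp (-(x * t)) * g x) := by
  obtain ⟨hfin, M, hM⟩ := hν
  obtain ⟨c, hc⟩ := exists_bound_of_abs_le hg M
  simp only [← cint_const_mul]
  have hae : ∀ᵐ x ∂ν.variation, |x| ≤ M := by
    filter_upwards [measure_eq_zero_iff_ae_notMem.1 hM] with x hx using not_lt.1 hx
  refine VectorMeasure.hasSum_integral_of_dominated_convergence
    (fun n _ => (|M| * |t|) ^ n / n.factorial * |c|) (fun n => ?_) (fun n => ?_) ?_ ?_ ?_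
  · exact Continuous.aestronglyMeasurable (by fun_prop)
  · filter_upwards [hae] with x hx
    rw [norm_mul, norm_mul, norm_mul, norm_pow, norm_pow, norm_inv, norm_neg, Complex.norm_real,
      Complex.norm_real, Complex.norm_natCast, Real.norm_eq_abs, Real.norm_eq_abs, mul_pow]
    calc (n.factorial : ℝ)⁻¹ * |t| ^ n * (|x| ^ n * ‖g x‖)
        ≤ (n.factorial : ℝ)⁻¹ * |t| ^ n * (|M| ^ n * |c|) := by
          have h1 := pow_le_pow_left₀ (abs_nonneg x) (hx.trans (le_abs_self M)) n
          have h2 := (hc x hx).trans (le_abs_self c)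
          exact mul_le_mul_of_nonneg_left (mul_le_mul h1 h2 (norm_nonneg _) (by positivity))
            (by positivity)
      _ = _ := by ring
  · exact ae_of_all _ fun _ => (Real.summable_pow_div_factorial _).mul_right _
  · exact integrable_const _
  · refine ae_of_all _ fun x => ?_
    have h1 := (NormedSpace.exp_series_hasSum_exp' (𝕂 := ℂ) (-(x * t) : ℂ)).mul_right (g x)
    rw [← Complex.exp_eq_exp_ℂ] at h1
    refine Eq.mp (congrArg (fun f => HasSum f _) (funext fun n => Eq.symm ?_)) h1
    rw [smul_eq_mul, neg_mul_eq_mul_neg, mul_pow]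
    ring

/-- **Karlin-McGregor representation.** For an orthogonal polynomial left eigenvector `P` of the
banded matrix `K`, the blocks of `e^{tK}` are given by spectral integrals. -/
theorem IsEigenRow.pairing_exp (hP : IsEigenRow K S P) (hK : ColBounded K) (hS : BandedBy K S)
    (hU : ∀ k l, BddSupport (U k l))
    (hG : ∀ j i, pairing U (fun _ => 1) (P j) (P i) = if j = i then G j else 0)
    (t : ℝ) (j i : V) :
    pairing U (fun x => Complex.exp (-(x * t))) (P j) (P i) =
      G j * blockOf (NormedSpace.exp ((t : ℂ) • blockOp K hK)) j i := by
  have hU' : ∀ k l, ∀ n : ℕ, (U k l).Integrable fun x : ℝ => (x : ℂ) ^ n :=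
    fun k l n => (hU k l).integrable (by fun_prop)
  ext a b
  have h1 : HasSum (fun n : ℕ => ((n.factorial : ℂ)⁻¹ * (-t : ℂ) ^ n) *
      pairing U (fun x => (x : ℂ) ^ n) (P j) (P i) a b)
      (pairing U (fun x => Complex.exp (-(x * t))) (P j) (P i) a b) := by
    simp only [pairing, Matrix.of_apply, Finset.mul_sum, mul_assoc (Complex.exp _),
      mul_assoc ((_ : ℂ) ^ _) (star _)]
    refine hasSum_sum fun k _ => hasSum_sum fun l _ => (hU k l).hasSum_cint_exp ?_ t
    exact (continuous_of_mem_polyFun (star_mem_polyFun (hP.mem_polyFun j k a))).mul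
      (continuous_of_mem_polyFun (hP.mem_polyFun i l b))
  have h2 : HasSum (fun n : ℕ => ((n.factorial : ℂ)⁻¹ * (-t : ℂ) ^ n) *
      pairing U (fun x => (x : ℂ) ^ n) (P j) (P i) a b)
      ((G j * blockOf (NormedSpace.exp ((t : ℂ) • blockOp K hK)) j i) a b) := by
    rw [Matrix.mul_apply]
    have h3 := hasSum_sum (s := Finset.univ) fun c _ =>
      (hasSum_blockOf_exp (blockOp K hK) t j i c b).mul_left (G j a c)
    refine Eq.mp (congrArg (fun f => HasSum f _) (funext fun n => Eq.symm ?_)) h3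
    rw [hP.pairing_pow hK hS hU' hG, Matrix.smul_apply, Matrix.mul_apply, smul_eq_mul,
      Finset.mul_sum, Finset.mul_sum]
    refine Finset.sum_congr rfl fun c _ => ?_
    have h4 : (-t : ℂ) ^ n * (-1) ^ n = (t : ℂ) ^ n := by rw [← mul_pow, neg_mul_neg, mul_one]
    rw [← h4]
    ring
  exact h1.unique h2

end Representation

/-! ### The polynomials of the walk and their folding -/

/-- A matrix-valued function with polynomial entries. -/
def MatPoly {m n : Type} (Q : ℝ → Matrix m n ℂ) : Prop := ∀ k a, (fun x => Q x k a) ∈ polyFun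

section MatPoly

variable {m n : Type} {P Q : ℝ → Matrix m n ℂ}

theorem MatPoly.sub (hP : MatPoly P) (hQ : MatPoly Q) : MatPoly fun x => P x - Q x :=
  fun k a => polyFun.sub_mem (hP k a) (hQ k a)

theorem MatPoly.mul_const [Fintype n] (hP : MatPoly P) (C : Matrix n n ℂ) :
    MatPoly fun x => P x * C := fun k a => by
  have : (fun x => (P x * C) k a) = ∑ c, (fun x => P x k c) * fun _ => C c a := by
    funext x
    simp [Matrix.mul_apply]
  rw [this]
  exact polyFun.sum_mem fun c _ => polyFun.mul_mem (hP k c) (const_mem_polyFun _)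

theorem MatPoly.neg_smul (hP : MatPoly P) : MatPoly fun x => -((x : ℂ) • P x) :=
  fun k a => polyFun.neg_mem (polyFun.mul_mem coe_mem_polyFun (hP k a))

theorem MatPoly.const (C : Matrix m n ℂ) : MatPoly fun _ => C := fun _ _ => const_mem_polyFun _

end MatPoly

namespace Walk

variable {d : ℕ} (w : Walk d)

theorem matPoly_polyUp (α : Fin 2) (n : ℕ) :
    MatPoly (fun x => (w.polyUp α x n).1) ∧ MatPoly (fun x => (w.polyUp α x n).2) := by
  induction n with
  | zero =>
    constructor <;> (fin_cases α <;> simpa [polyUp] using! MatPoly.const _)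
  | succ n ih =>
    exact ⟨ih.2, ((ih.2.neg_smul.sub (ih.2.mul_const _)).sub (ih.1.mul_const _)).mul_const _⟩

theorem matPoly_polyDown (α : Fin 2) (n : ℕ) :
    MatPoly (fun x => (w.polyDown α x n).1) ∧ MatPoly (fun x => (w.polyDown α x n).2) := by
  induction n with
  | zero =>
    constructor <;> (fin_cases α <;> simpa [polyDown] using! MatPoly.const _)
  | succ n ih =>
    exact ⟨ih.2, ((ih.2.neg_smul.sub (ih.2.mul_const _)).sub (ih.1.mul_const _)).mul_const _⟩

theorem matPoly_poly (α : Fin 2) (n : ℤ) : MatPoly (w.poly α n) := by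
  cases n with
  | ofNat k => exact (w.matPoly_polyUp α k).2
  | negSucc k => exact (w.matPoly_polyDown α k).2

theorem poly_zero_zero (x : ℝ) : w.poly 0 0 x = 1 := by
  change (w.polyUp 0 x 0).2 = 1
  simp [polyUp]

theorem poly_one_zero (x : ℝ) : w.poly 1 0 x = 0 := by
  change (w.polyUp 1 x 0).2 = 0
  simp [polyUp]

theorem poly_zero_neg_one (x : ℝ) : w.poly 0 (-1) x = 0 := by
  change (w.polyDown 0 x 0).2 = 0
  simp [polyDown]

theorem poly_one_neg_one (x : ℝ) : w.poly 1 (-1) x = 1 := by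
  change (w.polyDown 1 x 0).2 = 1
  simp [polyDown]

/-- The block column `[Q_n^1; Q_n^2]`. -/
def col (n : ℤ) (x : ℝ) : Matrix (Fin d × Fin d ⊕ Fin d × Fin d) (Fin d × Fin d) ℂ :=
  Matrix.fromRows (w.poly 0 n x) (w.poly 1 n x)

/-- The neighbourhood of a site of `ℤ`. -/
def nbhd (i : ℤ) : Finset ℤ := {i + 1, i, i - 1}

/-- The neighbourhood of a site of `ℤ_{≥0}`. -/
def foldNbhd : ℕ → Finset ℕ
  | 0 => {1, 0}
  | n + 1 => {n + 2, n + 1, n}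

theorem bandedBy_gen : BandedBy w.gen nbhd := by
  intro i j hj
  simp only [nbhd, Finset.mem_insert, Finset.mem_singleton, not_or] at hj
  simp [gen, hj.1, hj.2.1, hj.2.2]

theorem bandedBy_foldGen : BandedBy w.foldGen foldNbhd := by
  intro i j hj
  cases i with
  | zero =>
    simp only [foldNbhd, Finset.mem_insert, Finset.mem_singleton, not_or] at hj
    simp [foldGen, hj.1, hj.2]
  | succ n =>
    simp only [foldNbhd, Finset.mem_insert, Finset.mem_singleton, not_or] at hj
    simp [foldGen, hj.1, hj.2.1, hj.2.2]

theorem gen_up (i : ℤ) : w.gen (i + 1) i = dbl (w.A i) := by simp [gen]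

theorem gen_self (i : ℤ) : w.gen i i = w.diag i := by simp [gen]

theorem gen_down (i : ℤ) : w.gen (i - 1) i = dbl (w.C i) := by
  have h : ¬ i - 1 = i + 1 := by omega
  simp [gen, h]

theorem sum_nbhd_mul_gen {M : Type} [AddCommMonoid M] (i : ℤ)
    (f : ℤ → Matrix (Fin d × Fin d) (Fin d × Fin d) ℂ → M) :
    ∑ k ∈ nbhd i, f k (w.gen k i) =
      f (i + 1) (dbl (w.A i)) + f i (w.diag i) + f (i - 1) (dbl (w.C i)) := by
  have h1 : i + 1 ∉ ({i, i - 1} : Finset ℤ) := by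
    simp only [Finset.mem_insert, Finset.mem_singleton]; omega
  have h2 : i ∉ ({i - 1} : Finset ℤ) := by
    simp only [Finset.mem_singleton]; omega
  rw [nbhd, Finset.sum_insert h1, Finset.sum_insert h2, Finset.sum_singleton, gen_up, gen_self,
    gen_down, add_assoc]

variable {w} (hA : ∀ n : ℤ, 0 ≤ n → IsUnit (w.A n).det)
  (hC : ∀ n : ℤ, n ≤ -1 → IsUnit (w.C n).det)

include hA hC

theorem isEigenRow_col : IsEigenRow w.gen nbhd w.col where
  mem_polyFun i k a := by
    rcases k with k | k
    · exact w.matPoly_poly 0 i k a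
    · exact w.matPoly_poly 1 i k a
  sum_mul i x := by
    rw [w.sum_nbhd_mul_gen i fun k M => w.col k x * M]
    simp only [col, Matrix.fromRows_mul]
    ext (a | a) b
    · exact (congrFun₂ (w.poly_recurrence hA hC 0 i x) a b).symm
    · exact (congrFun₂ (w.poly_recurrence hA hC 1 i x) a b).symm

theorem isUnit_det_foldM (n : ℕ) : IsUnit (w.foldM n).det := by
  rw [foldM, Matrix.det_fromBlocks_zero₂₁]
  exact (isUnit_det_dbl (hA _ (by omega))).mul (isUnit_det_dbl (hC _ (by omega)))

theorem foldPoly_one_mul (x : ℝ) :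
    w.foldPoly 1 x * w.foldM 0 + w.foldPoly 0 x * w.foldD 0 = -((x : ℂ) • w.foldPoly 0 x) := by
  simp only [foldPoly]
  rw [Matrix.mul_assoc, Matrix.nonsing_inv_mul _ (isUnit_det_foldM hA hC 0)]
  simp

theorem foldPoly_add_two_mul (n : ℕ) (x : ℝ) :
    w.foldPoly (n + 2) x * w.foldM (n + 1) + w.foldPoly (n + 1) x * w.foldD (n + 1) +
      w.foldPoly n x * w.foldN (n + 1) = -((x : ℂ) • w.foldPoly (n + 1) x) := by
  rw [foldPoly, Matrix.mul_assoc, Matrix.nonsing_inv_mul _ (isUnit_det_foldM hA hC (n + 1)),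
    Matrix.mul_one]
  abel

/-- The folded polynomial `𝒬_n` has the block columns of the sites `n` and `-n-1`. -/
theorem foldPoly_eq (n : ℕ) (x : ℝ) :
    w.foldPoly n x = Matrix.fromBlocks (w.poly 0 n x) (w.poly 0 (-(n : ℤ) - 1) x)
      (w.poly 1 n x) (w.poly 1 (-(n : ℤ) - 1) x) := by
  set F : ℕ → Matrix (Fin d × Fin d ⊕ Fin d × Fin d) (Fin d × Fin d ⊕ Fin d × Fin d) ℂ :=
    fun n => Matrix.fromBlocks (w.poly 0 n x) (w.poly 0 (-(n : ℤ) - 1) x)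
      (w.poly 1 n x) (w.poly 1 (-(n : ℤ) - 1) x) with hF
  have hrec := fun α n => w.poly_recurrence hA hC α n x
  have h0 : w.foldPoly 0 x = F 0 := by
    rw [hF]
    simp only [foldPoly, Nat.cast_zero, neg_zero, zero_sub, poly_zero_zero, poly_zero_neg_one,
      poly_one_zero, poly_one_neg_one, Matrix.fromBlocks_one]
  have hF1 : F 1 * w.foldM 0 + F 0 * w.foldD 0 = -((x : ℂ) • F 0) := by
    simp only [hF, foldM, foldD, if_true, Matrix.fromBlocks_multiply, Matrix.fromBlocks_add,
      Matrix.fromBlocks_smul, Matrix.fromBlocks_neg, hrec]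
    norm_num
    refine ⟨?_, ?_, ?_, ?_⟩ <;> abel
  have hF2 : ∀ n, F (n + 2) * w.foldM (n + 1) + F (n + 1) * w.foldD (n + 1) +
      F n * w.foldN (n + 1) = -((x : ℂ) • F (n + 1)) := by
    intro n
    simp only [hF, foldM, foldD, foldN, Nat.succ_ne_zero, if_false, Matrix.fromBlocks_multiply,
      Matrix.fromBlocks_add, Matrix.fromBlocks_smul, Matrix.fromBlocks_neg, hrec]
    rw [show ((n + 2 : ℕ) : ℤ) = (n + 1 : ℕ) + 1 by push_cast; ring,
      show -(((n + 1 : ℕ) : ℤ) + 1) - 1 = -((n + 1 : ℕ) : ℤ) - 1 - 1 by ring,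
      show -(n : ℤ) - 1 = -((n + 1 : ℕ) : ℤ) - 1 + 1 by push_cast; ring,
      show (n : ℤ) = ((n + 1 : ℕ) : ℤ) - 1 by push_cast; ring]
    simp only [Matrix.mul_zero, add_zero, zero_add]
    congr 1 <;> abel
  have hcancel : ∀ (n : ℕ) {X Y : Matrix (Fin d × Fin d ⊕ Fin d × Fin d)
      (Fin d × Fin d ⊕ Fin d × Fin d) ℂ}, X * w.foldM n = Y * w.foldM n → X = Y := by
    intro n X Y h
    have hM := Matrix.mul_nonsing_inv _ (isUnit_det_foldM hA hC n)
    calc X = X * w.foldM n * (w.foldM n)⁻¹ := by rw [Matrix.mul_assoc, hM, Matrix.mul_one]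
      _ = Y := by rw [h, Matrix.mul_assoc, hM, Matrix.mul_one]
  suffices h : w.foldPoly n x = F n ∧ w.foldPoly (n + 1) x = F (n + 1) from h.1
  induction n with
  | zero =>
    refine ⟨h0, hcancel 0 ?_⟩
    have h1 := foldPoly_one_mul hA hC x
    rw [h0, ← hF1] at h1
    exact add_right_cancel h1
  | succ n ih =>
    refine ⟨ih.2, hcancel (n + 1) ?_⟩
    have h1 := foldPoly_add_two_mul hA hC n x
    rw [ih.1, ih.2, ← hF2] at h1
    exact add_right_cancel (add_right_cancel h1)

theorem foldPoly_apply_inl (n : ℕ) (x : ℝ) (k : Fin d × Fin d ⊕ Fin d × Fin d)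
    (a : Fin d × Fin d) : w.foldPoly n x k (Sum.inl a) = w.col n x k a := by
  rw [foldPoly_eq hA hC]
  rcases k with k | k <;> rfl

theorem foldPoly_apply_inr (n : ℕ) (x : ℝ) (k : Fin d × Fin d ⊕ Fin d × Fin d)
    (a : Fin d × Fin d) : w.foldPoly n x k (Sum.inr a) = w.col (-(n : ℤ) - 1) x k a := by
  rw [foldPoly_eq hA hC]
  rcases k with k | k <;> rfl

theorem isEigenRow_foldPoly : IsEigenRow w.foldGen foldNbhd w.foldPoly where
  mem_polyFun i k a := by
    rcases a with a | a
    · simp only [foldPoly_apply_inl hA hC]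
      exact (isEigenRow_col hA hC).mem_polyFun i k a
    · simp only [foldPoly_apply_inr hA hC]
      exact (isEigenRow_col hA hC).mem_polyFun _ k a
  sum_mul i x := by
    have hup : ∀ i, w.foldGen (i + 1) i = w.foldM i := fun i => by simp [foldGen]
    have hself : ∀ i, w.foldGen i i = w.foldD i := fun i => by simp [foldGen]
    have hdown : ∀ i, w.foldGen i (i + 1) = w.foldN (i + 1) := fun i => by
      have h : ¬ i = i + 1 + 1 := by omega
      simp [foldGen, h]
    cases i with
    | zero =>
      rw [foldNbhd, Finset.sum_pair one_ne_zero, hself, ← foldPoly_one_mul hA hC]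
      congr 2
    | succ n =>
      have h1 : n + 2 ∉ ({n + 1, n} : Finset ℕ) := by
        simp only [Finset.mem_insert, Finset.mem_singleton]; omega
      have h2 : n + 1 ∉ ({n} : Finset ℕ) := by
        simp only [Finset.mem_singleton]; omega
      rw [foldNbhd, Finset.sum_insert h1, Finset.sum_insert h2, Finset.sum_singleton, hup, hself,
        hdown, ← foldPoly_add_two_mul hA hC, add_assoc]

omit hA hC

/-- The blocks of the pairing of two block matrices are the pairings of their block columns. -/
theorem pairing_foldPoly (hA : ∀ n : ℤ, 0 ≤ n → IsUnit (w.A n).det)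
    (hC : ∀ n : ℤ, n ≤ -1 → IsUnit (w.C n).det)
    (W : MatrixMeasure (Fin d × Fin d ⊕ Fin d × Fin d)) (φ : ℝ → ℂ) (j i : ℕ) :
    pairing W φ (w.foldPoly j) (w.foldPoly i) = Matrix.fromBlocks
      (pairing W φ (w.col j) (w.col i)) (pairing W φ (w.col j) (w.col (-(i : ℤ) - 1)))
      (pairing W φ (w.col (-(j : ℤ) - 1)) (w.col i))
      (pairing W φ (w.col (-(j : ℤ) - 1)) (w.col (-(i : ℤ) - 1))) := by
  ext (a | a) (b | b) <;>
    simp only [pairing, Matrix.of_apply, Matrix.fromBlocks_apply₁₁, Matrix.fromBlocks_apply₁₂,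
      Matrix.fromBlocks_apply₂₁, Matrix.fromBlocks_apply₂₂, foldPoly_apply_inl hA hC,
      foldPoly_apply_inr hA hC]

theorem sum_sandwich_measBlock (W : MatrixMeasure (Fin d × Fin d ⊕ Fin d × Fin d)) (φ : ℝ → ℂ)
    (M : Matrix (Fin d × Fin d) (Fin d × Fin d) ℂ) (j i : ℤ) :
    ∑ α : Fin 2, ∑ β : Fin 2, M * sandwich (measBlock W α β) φ (w.poly α j) (w.poly β i) =
      M * pairing W φ (w.col j) (w.col i) := by
  simp only [← Matrix.mul_sum]
  congr 1
  ext a b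
  simp only [Fin.sum_univ_two, Matrix.add_apply, sandwich, pairing, Matrix.of_apply,
    Fintype.sum_sum_type, Finset.sum_add_distrib]
  rfl

theorem pairingIntegrable_col_iff (W : MatrixMeasure (Fin d × Fin d ⊕ Fin d × Fin d)) (φ : ℝ → ℂ)
    (j i : ℤ) : PairingIntegrable W φ (w.col j) (w.col i) ↔
      ∀ α β : Fin 2, SandwichIntegrable (measBlock W α β) φ (w.poly α j) (w.poly β i) := by
  constructor
  · intro h α β a b k l
    have := h a b (if α = 0 then Sum.inl k else Sum.inr k) (if β = 0 then Sum.inl l else Sum.inr l)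
    fin_cases α <;> fin_cases β <;> exact this
  · rintro h a b (k | k) (l | l)
    · exact h 0 0 a b k l
    · exact h 0 1 a b k l
    · exact h 1 0 a b k l
    · exact h 1 1 a b k l

end Walk

/-! ### Existence of a spectral block matrix -/

namespace Walk

variable {d : ℕ} {w : Walk d}

/-- The Gram matrix `R_n^* R_n = Π_n⁻¹`. -/
def gram (R : ℤ → Matrix (Fin d × Fin d) (Fin d × Fin d) ℂ) (n : ℤ) :
    Matrix (Fin d × Fin d) (Fin d × Fin d) ℂ := (R n)ᴴ * R n

section Gram

variable {R : ℤ → Matrix (Fin d × Fin d) (Fin d × Fin d) ℂ}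

theorem conjTranspose_gram (n : ℤ) : (gram R n)ᴴ = gram R n := by
  rw [gram, Matrix.conjTranspose_mul, Matrix.conjTranspose_conjTranspose]

theorem isUnit_det_gram (hR : ∀ n : ℤ, IsUnit (R n).det) (n : ℤ) : IsUnit (gram R n).det := by
  rw [gram, Matrix.det_mul, Matrix.det_conjTranspose]
  exact ((hR n).map (starRingEnd ℂ)).mul (hR n)

theorem invGram_mul_gram (hR : ∀ n : ℤ, IsUnit (R n).det) (n : ℤ) : invGram R n * gram R n = 1 :=
  Matrix.nonsing_inv_mul _ (isUnit_det_gram hR n)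

/-- The block diagonal Gram matrix `diag(Π_n⁻¹, Π_{-n-1}⁻¹)` of the folded walk. -/
def foldGram (R : ℤ → Matrix (Fin d × Fin d) (Fin d × Fin d) ℂ) (n : ℕ) :
    Matrix (Fin d × Fin d ⊕ Fin d × Fin d) (Fin d × Fin d ⊕ Fin d × Fin d) ℂ :=
  Matrix.fromBlocks (gram R n) 0 0 (gram R (-(n : ℤ) - 1))

theorem foldInvGram_mul_foldGram (hR : ∀ n : ℤ, IsUnit (R n).det) (n : ℕ) :
    foldInvGram R n * foldGram R n = 1 := by
  rw [foldInvGram, foldGram, Matrix.fromBlocks_multiply]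
  simp [invGram_mul_gram hR]

theorem inv_foldInvGram (hR : ∀ n : ℤ, IsUnit (R n).det) (n : ℕ) :
    (foldInvGram R n)⁻¹ = foldGram R n :=
  Matrix.inv_eq_right_inv (foldInvGram_mul_foldGram hR n)

/-- The generator is symmetric for the form with Gram matrices `R_n^* R_n`. -/
theorem gram_mul_gen {E : ℤ → Matrix (Fin d × Fin d) (Fin d × Fin d) ℂ}
    (hE : ∀ n : ℤ, (E n).IsHermitian)
    (hbal : ∀ n : ℤ, (dbl (w.A n))ᴴ * gram R (n + 1) = gram R n * dbl (w.C (n + 1)))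
    (hdiag : ∀ n : ℤ, R n * w.diag n = E n * R n) (j i : ℤ) :
    gram R j * w.gen j i = (w.gen i j)ᴴ * gram R i := by
  by_cases h1 : j = i + 1
  · subst h1
    have h2 := w.gen_down (i + 1)
    rw [add_sub_cancel_right] at h2
    have h := congrArg Matrix.conjTranspose (hbal i)
    rw [Matrix.conjTranspose_mul, Matrix.conjTranspose_mul, conjTranspose_gram,
      conjTranspose_gram, Matrix.conjTranspose_conjTranspose] at h
    rw [gen_up, h2, h]
  by_cases h2 : j = i
  · subst h2
    rw [gen_self, gram, Matrix.mul_assoc, hdiag, ← Matrix.mul_assoc, ← Matrix.mul_assoc,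
      ← Matrix.conjTranspose_mul, hdiag, Matrix.conjTranspose_mul, (hE j).eq]
  by_cases h3 : j = i - 1
  · subst h3
    have h4 := w.gen_up (i - 1)
    have h5 := hbal (i - 1)
    rw [sub_add_cancel] at h4 h5
    rw [gen_down, h4, h5]
  · have h4 : ¬ i = j + 1 := by omega
    have h5 : ¬ i = j := by omega
    have h6 : ¬ i = j - 1 := by omega
    simp [gen, h1, h2, h3, h4, h5, h6]

end Gram

/-- A sequence of families `(Z_i(n))_i` that the generator shifts (`Z(n) L = -Z(n+1)`) and that
vanishes at the sites `0` and `-1` is zero, as `A_i` for `i ≥ 0` and `C_i` for `i ≤ -1` can be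
cancelled in the three-term recurrence. -/
theorem eq_zero_of_recurrence (hA : ∀ n : ℤ, 0 ≤ n → IsUnit (w.A n).det)
    (hC : ∀ n : ℤ, n ≤ -1 → IsUnit (w.C n).det)
    {Z : ℕ → ℤ → Matrix (Fin d × Fin d) (Fin d × Fin d) ℂ}
    (hZ : ∀ n i, ∑ k ∈ nbhd i, Z n k * w.gen k i = -Z (n + 1) i)
    (h0 : ∀ n, Z n 0 = 0) (h1 : ∀ n, Z n (-1) = 0) (n : ℕ) (i : ℤ) : Z n i = 0 := by
  have hrec : ∀ n i, Z n (i + 1) * dbl (w.A i) + Z n i * w.diag i + Z n (i - 1) * dbl (w.C i) =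
      -Z (n + 1) i := fun n i => by
    rw [← hZ n i, w.sum_nbhd_mul_gen i fun k M => Z n k * M]
  have hcancel : ∀ {X B : Matrix (Fin d × Fin d) (Fin d × Fin d) ℂ}, IsUnit B.det → X * B = 0 →
      X = 0 := by
    intro X B hB h
    rw [← Matrix.mul_one X, ← Matrix.mul_nonsing_inv _ hB, ← Matrix.mul_assoc, h, Matrix.zero_mul]
  have hup : ∀ k : ℕ, (∀ n, Z n k = 0) ∧ ∀ n, Z n ((k : ℤ) - 1) = 0 := by
    intro k
    induction k with
    | zero => exact ⟨h0, h1⟩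
    | succ k ih =>
      refine ⟨fun n => ?_, fun n => ?_⟩
      · have h := hrec n k
        rw [ih.1, ih.1, ih.2, Matrix.zero_mul, Matrix.zero_mul, add_zero, add_zero, neg_zero] at h
        push_cast
        exact hcancel (isUnit_det_dbl (hA k (by omega))) h
      · push_cast
        rw [add_sub_cancel_right]
        exact ih.1 n
  have hdown : ∀ k : ℕ, (∀ n, Z n (-(k : ℤ) - 1) = 0) ∧ ∀ n, Z n (-(k : ℤ)) = 0 := by
    intro k
    induction k with
    | zero => exact ⟨h1, h0⟩
    | succ k ih =>
      refine ⟨fun n => ?_, fun n => ?_⟩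
      · have h := hrec n (-(k : ℤ) - 1)
        rw [sub_add_cancel, ih.1, ih.1, ih.2, Matrix.zero_mul, Matrix.zero_mul, zero_add, zero_add,
          neg_zero] at h
        have h2 := hcancel (isUnit_det_dbl (hC (-(k : ℤ) - 1) (by omega))) h
        rw [← h2]
        congr 1
        push_cast
        ring
      · have h2 := ih.1 n
        rw [← h2]
        congr 1
        push_cast
        ring
  rcases le_or_gt 0 i with hi | hi
  · obtain ⟨k, rfl⟩ := Int.eq_ofNat_of_zero_le hi
    exact (hup k).1 n
  · obtain ⟨k, rfl⟩ : ∃ k : ℕ, i = -(k : ℤ) - 1 := ⟨(-i - 1).toNat, by omega⟩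
    exact (hdown k).1 n

/-- The standard basis vectors at the sites `0` (left summand) and `-1` (right summand) of `ℤ`. -/
def baseVec : Fin d × Fin d ⊕ Fin d × Fin d → (ℤ →₀ EuclideanSpace ℂ (Fin d × Fin d)) :=
  Sum.elim (fun a => Finsupp.single 0 (EuclideanSpace.single a 1))
    (fun a => Finsupp.single (-1) (EuclideanSpace.single a 1))

theorem col_zero (x : ℝ) (k : Fin d × Fin d ⊕ Fin d × Fin d) (a : Fin d × Fin d) :
    w.col 0 x k a = if k = Sum.inl a then 1 else 0 := by
  rcases k with k | k
  · change w.poly 0 0 x k a = _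
    simp [poly_zero_zero, Matrix.one_apply]
  · change w.poly 1 0 x k a = _
    simp [poly_one_zero]

theorem col_neg_one (x : ℝ) (k : Fin d × Fin d ⊕ Fin d × Fin d) (a : Fin d × Fin d) :
    w.col (-1) x k a = if k = Sum.inr a then 1 else 0 := by
  rcases k with k | k
  · change w.poly 0 (-1) x k a = _
    simp [poly_zero_neg_one]
  · change w.poly 1 (-1) x k a = _
    simp [poly_one_neg_one, Matrix.one_apply]

end Walk

/-- If the columns of `P` and `Q` are constant standard basis vectors, then the entries of their
pairing are integrals against single entries of the matrix measure. -/
theorem pairing_of_indicator {κ ι : Type} [Fintype κ] [DecidableEq κ] (U : MatrixMeasure κ)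
    (φ : ℝ → ℂ) {P Q : ℝ → Matrix κ ι ℂ} {f g : ι → κ}
    (hP : ∀ x k a, P x k a = if k = f a then 1 else 0)
    (hQ : ∀ x k a, Q x k a = if k = g a then 1 else 0) (a b : ι) :
    pairing U φ P Q a b = cint (U (f a) (g b)) φ := by
  simp only [pairing, Matrix.of_apply, hP, hQ]
  rw [Finset.sum_eq_single (f a), Finset.sum_eq_single (g b)]
  · simp
  · intro l _ hl
    simp [hl]
  · simp
  · intro k _ hk
    simp [hk]
  · simp

namespace Walk

variable {d : ℕ} {w : Walk d}

section Existence

open scoped InnerProductSpace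

variable {R : ℤ → Matrix (Fin d × Fin d) (Fin d × Fin d) ℂ}

/-- The blocks `Π_j⁻¹ ((-L)ⁿ)_{ji}`, written as inner products of the weighted space. -/
def momentBlock (w : Walk d) (R : ℤ → Matrix (Fin d × Fin d) (Fin d × Fin d) ℂ) (n : ℕ)
    (j i : ℤ) : Matrix (Fin d × Fin d) (Fin d × Fin d) ℂ :=
  Matrix.of fun a b =>
    ⟪weightEmb 2 R (Finsupp.single j (EuclideanSpace.single a 1)),
      weightEmb 2 R (((-finOp w.gen nbhd) ^ n)
        (Finsupp.single i (EuclideanSpace.single b 1)))⟫_ℂ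

theorem momentBlock_zero (j i : ℤ) :
    momentBlock w R 0 j i = if j = i then gram R j else 0 := by
  ext a b
  rw [momentBlock, Matrix.of_apply, pow_zero, Module.End.one_apply, inner_weightEmb_single,
    EuclideanSpace.inner_single_left]
  by_cases h : j = i
  · subst h
    rw [if_pos rfl, Finsupp.single_eq_same, map_one, one_mul]
    change (((R j)ᴴ * R j) *ᵥ (Pi.single b 1 : Fin d × Fin d → ℂ)) a = _
    simp [gram]
  · rw [if_neg h, Finsupp.single_eq_of_ne h, map_zero]
    simp

theorem momentBlock_succ (n : ℕ) (j i : ℤ) :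
    ∑ k ∈ nbhd i, momentBlock w R n j k * w.gen k i = -momentBlock w R (n + 1) j i := by
  ext a b
  have h1 : ∀ k, Finsupp.single k (Matrix.toEuclideanCLM (𝕜 := ℂ) (w.gen k i)
      (EuclideanSpace.single b 1)) =
      ∑ c, w.gen k i c b • Finsupp.single k (EuclideanSpace.single c (1 : ℂ)) := by
    intro k
    simp only [Finsupp.smul_single]
    rw [← Finsupp.single_finsetSum]
    congr 1
    ext c
    change (w.gen k i *ᵥ (Pi.single b 1 : Fin d × Fin d → ℂ)) c = _
    simp [Pi.single_apply]
  rw [Matrix.neg_apply, momentBlock, Matrix.of_apply, pow_succ, Module.End.mul_apply,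
    LinearMap.neg_apply, map_neg, map_neg, inner_neg_right, neg_neg, finOp_single]
  simp only [h1, map_sum, map_smul, inner_sum, inner_smul_right, Matrix.sum_apply,
    Matrix.mul_apply, momentBlock, Matrix.of_apply]
  exact Finset.sum_congr rfl fun k _ => Finset.sum_congr rfl fun c _ => mul_comm _ _

theorem neg_finOp_symmetric
    (hsym : ∀ j i, gram R j * w.gen j i = (w.gen i j)ᴴ * gram R i)
    (f g : ℤ →₀ EuclideanSpace ℂ (Fin d × Fin d)) :
    ⟪weightEmb 2 R ((-finOp w.gen nbhd) f), weightEmb 2 R g⟫_ℂ =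
      ⟪weightEmb 2 R f, weightEmb 2 R ((-finOp w.gen nbhd) g)⟫_ℂ := by
  rw [LinearMap.neg_apply, LinearMap.neg_apply, map_neg, map_neg, inner_neg_left, inner_neg_right,
    finOp_symmetric w.bandedBy_gen hsym]

theorem conjTranspose_momentBlock
    (hsym : ∀ j i, gram R j * w.gen j i = (w.gen i j)ᴴ * gram R i) (n : ℕ) (j i : ℤ) :
    (momentBlock w R n j i)ᴴ = momentBlock w R n i j := by
  ext a b
  rw [Matrix.conjTranspose_apply, momentBlock, momentBlock, Matrix.of_apply, Matrix.of_apply,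
    Complex.star_def, inner_conj_symm, inner_pow_of_symmetric (neg_finOp_symmetric hsym)]

/-- Krein's bound makes `-L` a bounded self-adjoint operator of the weighted `ℓ²` space, whose
spectral measures at the sites `0` and `-1` form a weight matrix. -/
theorem exists_isWeight_momentBlock (hR : ∀ n : ℤ, IsUnit (R n).det)
    (hsym : ∀ j i, gram R j * w.gen j i = (w.gen i j)ᴴ * gram R i) :
    ∃ W : MatrixMeasure (Fin d × Fin d ⊕ Fin d × Fin d), IsWeight W ∧
      ∀ k l n, cint (W k l) (fun x => (x : ℂ) ^ n) =
        ⟪weightEmb 2 R (baseVec k), weightEmb 2 R (((-finOp w.gen nbhd) ^ n) (baseVec l))⟫_ℂ := by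
  obtain ⟨W, h1, h2, h3⟩ := exists_matrixMeasure_of_symmetric (denseRange_weightEmb hR)
    (neg_finOp_symmetric hsym) (M := ‖blockOp w.gen w.colBounded_gen‖ + 1) (by positivity)
    (fun f => by
      obtain ⟨C, hC⟩ := inner_finOp_growth w.colBounded_gen w.bandedBy_gen R f
      refine ⟨C, fun n => ?_⟩
      refine le_trans (le_of_eq ?_) (hC n)
      rcases Nat.even_or_odd n with h | h
      · rw [show (-finOp w.gen nbhd) ^ n = finOp w.gen nbhd ^ n from
          h.neg_pow (finOp w.gen nbhd : Module.End ℂ (ℤ →₀ EuclideanSpace ℂ (Fin d × Fin d)))]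
      · rw [show (-finOp w.gen nbhd) ^ n = -finOp w.gen nbhd ^ n from
          h.neg_pow (finOp w.gen nbhd : Module.End ℂ (ℤ →₀ EuclideanSpace ℂ (Fin d × Fin d))),
          LinearMap.neg_apply, map_neg, inner_neg_right, norm_neg]) (baseVec (d := d))
  exact ⟨W, ⟨h1, fun k l n => (h2 k l).integrable (by fun_prop)⟩, h3⟩

/-- A weight matrix with the moments of the walk at the sites `0` and `-1` makes the block columns
`[Q_n^1; Q_n^2]` orthogonal. -/
theorem exists_isWeight_orthogonal (hA : ∀ n : ℤ, 0 ≤ n → IsUnit (w.A n).det)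
    (hC : ∀ n : ℤ, n ≤ -1 → IsUnit (w.C n).det) (hR : ∀ n : ℤ, IsUnit (R n).det)
    (hsym : ∀ j i, gram R j * w.gen j i = (w.gen i j)ᴴ * gram R i) :
    ∃ W : MatrixMeasure (Fin d × Fin d ⊕ Fin d × Fin d), IsWeight W ∧
      ∀ j i, pairing W (fun _ => 1) (w.col j) (w.col i) = if j = i then gram R j else 0 := by
  obtain ⟨W, hW, hmom⟩ := exists_isWeight_momentBlock hR hsym
  refine ⟨W, hW, ?_⟩
  have hcol := isEigenRow_col hA hC
  -- The defect of the moments satisfies the recurrences on both sides.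
  set Z : ℕ → ℤ → ℤ → Matrix (Fin d × Fin d) (Fin d × Fin d) ℂ := fun n j i =>
    pairing W (fun x => (x : ℂ) ^ n) (w.col j) (w.col i) - momentBlock w R n j i with hZ
  have hright : ∀ n j i, ∑ k ∈ nbhd i, Z n j k * w.gen k i = -Z (n + 1) j i := by
    intro n j i
    simp only [hZ, Matrix.sub_mul, Finset.sum_sub_distrib]
    rw [hcol.pairing_succ_right hW.moments, momentBlock_succ]
    abel
  have hleft : ∀ n j i, ∑ k ∈ nbhd j, (Z n k i)ᴴ * w.gen k j = -(Z (n + 1) j i)ᴴ := by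
    intro n j i
    have h := congrArg Matrix.conjTranspose (hcol.pairing_succ_left hW.moments n j i)
    simp only [Matrix.conjTranspose_sum, Matrix.conjTranspose_mul,
      Matrix.conjTranspose_conjTranspose, Matrix.conjTranspose_neg] at h
    simp only [hZ, Matrix.conjTranspose_sub, Matrix.sub_mul, Finset.sum_sub_distrib,
      conjTranspose_momentBlock hsym]
    rw [h, momentBlock_succ]
    abel
  have hbase : ∀ n, (Z n 0 0 = 0 ∧ Z n 0 (-1) = 0) ∧ Z n (-1) 0 = 0 ∧ Z n (-1) (-1) = 0 := by
    intro n
    refine ⟨⟨?_, ?_⟩, ?_, ?_⟩ <;> ext a b <;>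
      simp only [hZ, Matrix.sub_apply, Matrix.zero_apply, sub_eq_zero]
    · exact (pairing_of_indicator W _ col_zero col_zero a b).trans (hmom _ _ n)
    · exact (pairing_of_indicator W _ col_zero col_neg_one a b).trans (hmom _ _ n)
    · exact (pairing_of_indicator W _ col_neg_one col_zero a b).trans (hmom _ _ n)
    · exact (pairing_of_indicator W _ col_neg_one col_neg_one a b).trans (hmom _ _ n)
  -- The rows of the sites `0` and `-1` vanish by the recurrence in `i`, the columns by that in `j`.
  have h0 : ∀ n i, Z n 0 i = 0 := eq_zero_of_recurrence hA hC (fun n i => hright n 0 i)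
    (fun n => (hbase n).1.1) fun n => (hbase n).1.2
  have h1 : ∀ n i, Z n (-1) i = 0 := eq_zero_of_recurrence hA hC (fun n i => hright n (-1) i)
    (fun n => (hbase n).2.1) fun n => (hbase n).2.2
  have hall : ∀ n j i, (Z n j i)ᴴ = 0 := fun n j i =>
    eq_zero_of_recurrence (Z := fun n j => (Z n j i)ᴴ) hA hC (fun n j => hleft n j i)
      (fun n => by simp [h0]) (fun n => by simp [h1]) n j
  intro j i
  have h2 := Matrix.conjTranspose_eq_zero.1 (hall 0 j i)
  simp only [hZ, pow_zero, sub_eq_zero] at h2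
  rw [h2, momentBlock_zero]

end Existence

/-! ### Spectral block matrices and the Karlin-McGregor formula -/

section Spectral

variable {R : ℤ → Matrix (Fin d × Fin d) (Fin d × Fin d) ℂ}

theorem exists_nat_eq_or_eq (j : ℤ) : (∃ n : ℕ, j = n) ∨ ∃ n : ℕ, j = -(n : ℤ) - 1 := by
  rcases le_or_gt 0 j with h | h
  · exact Or.inl ⟨j.toNat, by omega⟩
  · exact Or.inr ⟨(-j - 1).toNat, by omega⟩

/-- Orthogonality of the folded polynomials is orthogonality of the block columns
`[Q_n^1; Q_n^2]`, `n ∈ ℤ`. -/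
theorem isSpectral_iff (hA : ∀ n : ℤ, 0 ≤ n → IsUnit (w.A n).det)
    (hC : ∀ n : ℤ, n ≤ -1 → IsUnit (w.C n).det) (hR : ∀ n : ℤ, IsUnit (R n).det)
    {W : MatrixMeasure (Fin d × Fin d ⊕ Fin d × Fin d)} :
    w.IsSpectral R W ↔ IsWeight W ∧
      ∀ j i, pairing W (fun _ => 1) (w.col j) (w.col i) = if j = i then gram R j else 0 := by
  constructor
  · rintro ⟨h1, h2⟩
    refine ⟨h1, fun j i => ?_⟩
    have key : ∀ m n : ℕ, Matrix.fromBlocks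
        (pairing W (fun _ => 1) (w.col m) (w.col n))
        (pairing W (fun _ => 1) (w.col m) (w.col (-(n : ℤ) - 1)))
        (pairing W (fun _ => 1) (w.col (-(m : ℤ) - 1)) (w.col n))
        (pairing W (fun _ => 1) (w.col (-(m : ℤ) - 1)) (w.col (-(n : ℤ) - 1))) =
        if m = n then foldGram R m else 0 := by
      intro m n
      rw [← pairing_foldPoly hA hC, ← sandwich_eq_pairing, h2, inv_foldInvGram hR]
    have hz : (0 : Matrix (Fin d × Fin d ⊕ Fin d × Fin d) (Fin d × Fin d ⊕ Fin d × Fin d) ℂ) =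
        Matrix.fromBlocks 0 0 0 0 := Matrix.fromBlocks_zero.symm
    rcases exists_nat_eq_or_eq j with ⟨m, rfl⟩ | ⟨m, rfl⟩ <;>
      rcases exists_nat_eq_or_eq i with ⟨n, rfl⟩ | ⟨n, rfl⟩ <;>
      have h := key m n <;> by_cases hmn : m = n
    all_goals
      simp only [hmn, if_true, if_false, foldGram, hz, Matrix.fromBlocks_inj] at h
    · rw [hmn, if_pos rfl, h.1]
    · rw [if_neg (by omega), h.1]
    · rw [hmn, if_neg (by omega), h.2.1]
    · rw [if_neg (by omega), h.2.1]
    · rw [hmn, if_neg (by omega), h.2.2.1]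
    · rw [if_neg (by omega), h.2.2.1]
    · rw [hmn, if_pos rfl, h.2.2.2]
    · rw [if_neg (by omega), h.2.2.2]
  · rintro ⟨h1, h2⟩
    refine ⟨h1, fun m n => ?_⟩
    rw [sandwich_eq_pairing, pairing_foldPoly hA hC, inv_foldInvGram hR, h2, h2, h2, h2,
      if_neg (by omega : ¬ (m : ℤ) = -(n : ℤ) - 1), if_neg (by omega : ¬ -(m : ℤ) - 1 = (n : ℤ))]
    by_cases h : m = n
    · subst h
      simp [foldGram]
    · rw [if_neg h, if_neg (by omega), if_neg (by omega), Matrix.fromBlocks_zero]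

/-- A spectral block matrix is compactly supported: its moments are blocks of powers of the bounded
folded generator. -/
theorem IsSpectral.bddSupport (hA : ∀ n : ℤ, 0 ≤ n → IsUnit (w.A n).det)
    (hC : ∀ n : ℤ, n ≤ -1 → IsUnit (w.C n).det)
    {W : MatrixMeasure (Fin d × Fin d ⊕ Fin d × Fin d)} (hW : w.IsSpectral R W)
    (k l : Fin d × Fin d ⊕ Fin d × Fin d) : BddSupport (W k l) := by
  set L := blockOp w.foldGen w.colBounded_foldGen with hL
  set G := (foldInvGram R 0)⁻¹ with hG
  have hmom : ∀ k n, ‖cint (W k k) (fun x => (x : ℂ) ^ n)‖ ≤ (∑ k, ∑ c, ‖G k c‖) * ‖L‖ ^ n := by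
    intro k n
    have h1 : ∀ (x : ℝ) k a, w.foldPoly 0 x k a = if k = a then 1 else 0 := fun x k a => by
      simp [foldPoly, Matrix.one_apply]
    have h2 := (isEigenRow_foldPoly hA hC).pairing_pow w.colBounded_foldGen w.bandedBy_foldGen
      hW.isWeight.moments (G := fun j => (foldInvGram R j)⁻¹) hW.orthogonal n 0 0
    have h3 : cint (W k k) (fun x => (x : ℂ) ^ n) =
        pairing W (fun x => (x : ℂ) ^ n) (w.foldPoly 0) (w.foldPoly 0) k k :=
      (pairing_of_indicator W _ (f := id) (g := id) h1 h1 k k).symm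
    rw [h3, h2, Matrix.smul_apply, norm_smul,
      norm_pow, norm_neg, norm_one, one_pow, one_mul, Matrix.mul_apply]
    calc ‖∑ c, G k c * blockOf (L ^ n) 0 0 c k‖ ≤ ∑ c, ‖G k c‖ * ‖L‖ ^ n := by
          refine (norm_sum_le _ _).trans (Finset.sum_le_sum fun c _ => ?_)
          rw [norm_mul]
          exact mul_le_mul_of_nonneg_left ((norm_blockOf_le _ _ _ _ _).trans (norm_clm_pow_le L n))
            (norm_nonneg _)
      _ = (∑ c, ‖G k c‖) * ‖L‖ ^ n := by rw [Finset.sum_mul]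
      _ ≤ _ := mul_le_mul_of_nonneg_right
          (Finset.single_le_sum (f := fun k => ∑ c, ‖G k c‖)
            (fun _ _ => Finset.sum_nonneg fun _ _ => norm_nonneg _) (Finset.mem_univ k))
          (by positivity)
  exact hW.isWeight.bddSupport (norm_nonneg L) (fun k n => hmom k (2 * n)) k l

theorem IsSpectral.karlinMcGregor (hA : ∀ n : ℤ, 0 ≤ n → IsUnit (w.A n).det)
    (hC : ∀ n : ℤ, n ≤ -1 → IsUnit (w.C n).det) (hR : ∀ n : ℤ, IsUnit (R n).det)
    {W : MatrixMeasure (Fin d × Fin d ⊕ Fin d × Fin d)} (hW : w.IsSpectral R W) :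
    w.KarlinMcGregor R W := by
  intro t _ j i
  have hb := hW.bddSupport hA hC
  refine ⟨(pairingIntegrable_col_iff W _ j i).1
    ((isEigenRow_col hA hC).pairingIntegrable_exp hb t j i), ?_⟩
  rw [sum_sandwich_measBlock, (isEigenRow_col hA hC).pairing_exp w.colBounded_gen w.bandedBy_gen hb
    ((isSpectral_iff hA hC hR).1 hW).2, ← Matrix.mul_assoc, invGram_mul_gram hR, Matrix.one_mul]
  rfl

theorem IsSpectral.foldKarlinMcGregor (hA : ∀ n : ℤ, 0 ≤ n → IsUnit (w.A n).det)
    (hC : ∀ n : ℤ, n ≤ -1 → IsUnit (w.C n).det) (hR : ∀ n : ℤ, IsUnit (R n).det)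
    {W : MatrixMeasure (Fin d × Fin d ⊕ Fin d × Fin d)} (hW : w.IsSpectral R W) :
    w.FoldKarlinMcGregor R W := by
  intro t _ j i
  have hb := hW.bddSupport hA hC
  refine ⟨(isEigenRow_foldPoly hA hC).pairingIntegrable_exp hb t j i, ?_⟩
  rw [sandwich_eq_pairing, (isEigenRow_foldPoly hA hC).pairing_exp w.colBounded_foldGen
    w.bandedBy_foldGen hb (G := fun j => (foldInvGram R j)⁻¹) hW.orthogonal, ← Matrix.mul_assoc,
    inv_foldInvGram hR, foldInvGram_mul_foldGram hR, Matrix.one_mul]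
  rfl

theorem KarlinMcGregor.semigroup_eq {W : MatrixMeasure (Fin d × Fin d ⊕ Fin d × Fin d)}
    (hW : w.KarlinMcGregor R W) {t : ℝ} (ht : 0 ≤ t) (j i : ℤ) :
    invGram R j * pairing W (fun x => Complex.exp (-(x * t))) (w.col j) (w.col i) =
      w.semigroup t j i := by
  rw [(hW t ht j i).2, sum_sandwich_measBlock]

/-- If a matrix measure represents the semigroup of the walk, then it represents the folded
semigroup, because any two representing matrix measures have the same integrals and the folded
semigroup is represented by a spectral block matrix. -/
theorem KarlinMcGregor.fold (hA : ∀ n : ℤ, 0 ≤ n → IsUnit (w.A n).det)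
    (hC : ∀ n : ℤ, n ≤ -1 → IsUnit (w.C n).det) (hR : ∀ n : ℤ, IsUnit (R n).det)
    {W₀ W : MatrixMeasure (Fin d × Fin d ⊕ Fin d × Fin d)} (hW₀ : w.IsSpectral R W₀)
    (hW : w.KarlinMcGregor R W) : w.FoldKarlinMcGregor R W := by
  intro t ht j i
  constructor
  · have hint := fun j i => (pairingIntegrable_col_iff W _ j i).2 (hW t ht j i).1
    rintro (a | a) (b | b) k l
    · simpa only [foldPoly_apply_inl hA hC] using hint j i a b k l
    · simpa only [foldPoly_apply_inl hA hC, foldPoly_apply_inr hA hC] using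
        hint j (-(i : ℤ) - 1) a b k l
    · simpa only [foldPoly_apply_inl hA hC, foldPoly_apply_inr hA hC] using
        hint (-(j : ℤ) - 1) i a b k l
    · simpa only [foldPoly_apply_inr hA hC] using hint (-(j : ℤ) - 1) (-(i : ℤ) - 1) a b k l
  · rw [(hW₀.foldKarlinMcGregor hA hC hR t ht j i).2]
    simp only [sandwich_eq_pairing, pairing_foldPoly hA hC, foldInvGram,
      Matrix.fromBlocks_multiply, Matrix.zero_mul, add_zero, zero_add, hW.semigroup_eq ht,
      (hW₀.karlinMcGregor hA hC hR).semigroup_eq ht]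

end Spectral

end Walk

end CTOQW

end

theorem mainTheorem4 {d : ℕ} (w : CTOQW.Walk d)
    (hA : ∀ n : ℤ, 0 ≤ n → IsUnit (w.A n).det)
    (hC : ∀ n : ℤ, n ≤ -1 → IsUnit (w.C n).det)
    (R E : ℤ → Matrix (Fin d × Fin d) (Fin d × Fin d) ℂ)
    (hR : ∀ n : ℤ, IsUnit (R n).det)
    (hE : ∀ n : ℤ, (E n).IsHermitian)
    (hpos : ∀ n : ℤ, 0 ≤ n →
      (CTOQW.dbl (w.A n))ᴴ * ((R (n + 1))ᴴ * R (n + 1)) =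
        (R n)ᴴ * R n * CTOQW.dbl (w.C (n + 1)))
    (hneg : ∀ n : ℤ, 0 ≤ n →
      (R (-n - 1))ᴴ * R (-n - 1) * CTOQW.dbl (w.C (-n)) =
        (CTOQW.dbl (w.A (-n - 1)))ᴴ * ((R (-n))ᴴ * R (-n)))
    (hdiag : ∀ n : ℤ, R n * w.diag n = E n * R n) :
    (∃ W : CTOQW.MatrixMeasure (Fin d × Fin d ⊕ Fin d × Fin d), w.IsSpectral R W) ∧
    (∀ W : CTOQW.MatrixMeasure (Fin d × Fin d ⊕ Fin d × Fin d),
      w.IsSpectral R W → w.KarlinMcGregor R W) ∧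
    (∀ W : CTOQW.MatrixMeasure (Fin d × Fin d ⊕ Fin d × Fin d),
      w.KarlinMcGregor R W → w.FoldKarlinMcGregor R W) := by
  have hbal : ∀ n : ℤ, (CTOQW.dbl (w.A n))ᴴ * CTOQW.Walk.gram R (n + 1) =
      CTOQW.Walk.gram R n * CTOQW.dbl (w.C (n + 1)) := by
    intro n
    rcases le_or_gt 0 n with hn | hn
    · exact hpos n hn
    · have h := (hneg (-n - 1) (by omega)).symm
      rwa [show -(-n - 1) - 1 = n by ring, show -(-n - 1) = n + 1 by ring] at h
  have hsym := CTOQW.Walk.gram_mul_gen hE hbal hdiag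
  obtain ⟨W₀, hW₀⟩ := CTOQW.Walk.exists_isWeight_orthogonal hA hC hR hsym
  have hspec := (CTOQW.Walk.isSpectral_iff hA hC hR).2 hW₀
  exact ⟨⟨W₀, hspec⟩, fun W hW => hW.karlinMcGregor hA hC hR,
    fun W hW => hW.fold hA hC hR hspec⟩
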